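/- Let $X$ be a path-connected space that has the homotopy type of a CW complex, and let $R$ be a commutative ring with unit. An open cover of $X$ is called good if all its members and all their non-empty finite intersections are contractible; the strict covering type $\mathrm{sct}(X)$ is the minimal cardinality of a good cover of $X$ (and $\mathrm{sct}(X)=\infty$ if $X$ has no finite good cover). A subset of $X$ is categorical if its inclusion into $X$ is null-homotopic, and for $A\subseteq X$ let $\mathrm{cat}(A)$ be the minimal number of open categorical subsets of $X$ whose union contains $A$. The category weight $\mathrm{cwgt}(u)$ of a non-zero singular cohomology class $u\in H^q(X;R)$, $q\ge 1$, is the maximal $k$ such that $u|_A=0$ for every closed subset $A\subseteq X$ with $\mathrm{cat}(A)\le k$ ($\infty$ if there is no maximal such $k$). A weight estimator $\mathbf w$ assigns to every non-zero homogeneous class $u\in\widetilde H^*(X;R)$ a positive integer $\mathbf w(u)\le\mathrm{cwgt}(u)$. For a finite sequence $s=(u_1,\ldots,u_n)$ of homogeneous elements of $\widetilde H^*(X;R)$ put $\widehat s:=u_1\cdots u_n$ (cup product; $\widehat s = 1\in H^0(X;R)$ for the empty sequence), and, when $\widehat s\neq 0$, $\mathbf w(s):=\mathbf w(u_1)+\cdots+\mathbf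 w(u_n)$ and $|\widehat s|:=|u_1|+\cdots+|u_n|$, with the convention that $\mathbf w(s)=0$ and $|\widehat s|=-1$ if $s$ is empty. Write $s'\le s$ if $s'$ is, up to a permutation, a (possibly empty) subsequence of $s$. Theorem 3.2. For every weight estimator $\mathbf w$ and every finite sequence $s$ of homogeneous elements of $\widetilde H^*(X;R)$ with $\widehat s\ne 0$, $$\mathrm{sct}(X)\ \ge\ \mathrm{wct}(s;\mathbf w):=1+\mathbf w(s)+\sum_{k=1}^{\mathbf w(s)}\max\big\{|\widehat{s'}|\ :\ s'\le s,\ \mathbf w(s')\le k\big\}.$$ -/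

import Mathlib

open scoped BigOperators

noncomputable section

namespace CovType

universe u v

/-! ### Singular cohomology with coefficients in a commutative ring, and its cup product -/

section Cohomology

/-- Singular `n`-simplices of `X`: continuous maps from the standard `n`-simplex to `X`. -/
abbrev Simplex (X : Type u) [TopologicalSpace X] (n : ℕ) : Type u :=
  C(stdSimplex ℝ (Fin (n + 1)), X)

variable {X : Type u} [TopologicalSpace X]

/-- The singular `m`-simplex obtained from a singular `n`-simplex by precomposing it with the affine
map of standard simplices given on the vertices by `a`. -/
def Simplex.pull {m n : ℕ} (σ : Simplex X n) (a : Fin (m + 1) → Fin (n + 1)) : Simplex X m :=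
  σ.comp ⟨stdSimplex.map a, stdSimplex.continuous_map a⟩

theorem Simplex.pull_pull {l m n : ℕ} (σ : Simplex X n) (a : Fin (m + 1) → Fin (n + 1))
    (b : Fin (l + 1) → Fin (m + 1)) : (σ.pull a).pull b = σ.pull (a ∘ b) := by
  ext x
  simp [Simplex.pull, stdSimplex.map_comp_apply]

/-- The `i`-th face of a singular simplex. -/
def Simplex.face {n : ℕ} (σ : Simplex X (n + 1)) (i : Fin (n + 2)) : Simplex X n :=
  σ.pull i.succAbove

/-- The inclusion of the first `p + 1` vertices of the `n`-simplex. -/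
def frontVertices {p n : ℕ} (h : p ≤ n) : Fin (p + 1) → Fin (n + 1) :=
  Fin.castLE (Nat.succ_le_succ h)

/-- The inclusion of the last `q + 1` vertices of the `n`-simplex. -/
def backVertices {q n : ℕ} (h : q ≤ n) : Fin (q + 1) → Fin (n + 1) :=
  fun i => ⟨n - q + i, by omega⟩

variable (X) (R : Type v) [CommRing R]

/-- Singular `n`-cochains of `X` with coefficients in `R`. -/
abbrev Cochain (n : ℕ) : Type (max u v) := Simplex X n → R

/-- The coboundary operator `(d f) σ = ∑ i, (-1) ^ i • f (∂_i σ)`. -/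
def coboundary (n : ℕ) : Cochain X R n →ₗ[R] Cochain X R (n + 1) where
  toFun f σ := ∑ i : Fin (n + 2), (-1 : R) ^ (i : ℕ) * f (σ.face i)
  map_add' f g := by
    ext σ
    simp [mul_add, Finset.sum_add_distrib]
  map_smul' c f := by
    ext σ
    simp [Finset.mul_sum, mul_left_comm]

theorem coboundary_coboundary (n : ℕ) (f : Cochain X R n) :
    coboundary X R (n + 1) (coboundary X R n f) = 0 := by
  ext σ
  have h : coboundary X R (n + 1) (coboundary X R n f) σ =
      ∑ x : Fin (n + 3) × Fin (n + 2),
        (-1 : R) ^ ((x.1 : ℕ) + (x.2 : ℕ)) * f (σ.pull (x.1.succAbove ∘ x.2.succAbove)) := by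
    rw [Fintype.sum_prod_type]
    simp only [coboundary, LinearMap.coe_mk, AddHom.coe_mk, Finset.mul_sum, Simplex.face,
      Simplex.pull_pull, pow_add, mul_assoc]
  rw [h]
  refine Finset.sum_involution (fun x _ => (x.1.succAbove x.2, x.2.predAbove x.1)) ?_ ?_ ?_ ?_
  · rintro ⟨i, j⟩ -
    have e : (i.succAbove j).succAbove ∘ (j.predAbove i).succAbove =
        i.succAbove ∘ j.succAbove := by
      funext l
      simp [Fin.succAbove_succAbove_succAbove_predAbove]
    simp only [e, Fin.neg_one_pow_succAbove_add_predAbove]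
    ring
  · rintro ⟨i, j⟩ - - hij
    exact Fin.succAbove_ne i j (congrArg Prod.fst hij)
  · simp
  · rintro ⟨i, j⟩ -
    simp [Fin.succAbove_succAbove_predAbove, Fin.predAbove_predAbove_succAbove]

/-- Singular `n`-cocycles. -/
def cocycles (n : ℕ) : Submodule R (Cochain X R n) := LinearMap.ker (coboundary X R n)

/-- Singular `n`-coboundaries. -/
def coboundaries : (n : ℕ) → Submodule R (Cochain X R n)
  | 0 => ⊥
  | n + 1 => LinearMap.range (coboundary X R n)

theorem coboundaries_le_cocycles (n : ℕ) : coboundaries X R n ≤ cocycles X R n := by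
  cases n with
  | zero => exact bot_le
  | succ n =>
    rintro _ ⟨f, rfl⟩
    exact coboundary_coboundary X R n f

/-- The singular cohomology `H^n(X; R)`: cocycles modulo coboundaries. -/
abbrev Cohomology (n : ℕ) : Type (max u v) :=
  cocycles X R n ⧸ (coboundaries X R n).submoduleOf (cocycles X R n)

variable {X R}

/-- The cup product of cochains: `(f ∪ g) σ = f (front face of σ) * g (back face of σ)`. -/
def cupCochain {p q n : ℕ} (h : p + q = n) (f : Cochain X R p) (g : Cochain X R q) :
    Cochain X R n :=
  fun σ => f (σ.pull (frontVertices (by omega : p ≤ n))) *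
    g (σ.pull (backVertices (by omega : q ≤ n)))

/-- The Leibniz rule. -/
theorem coboundary_cupCochain {p q n : ℕ} (h : p + q = n) (f : Cochain X R p)
    (g : Cochain X R q) :
    coboundary X R n (cupCochain h f g) =
      cupCochain (by omega : (p + 1) + q = n + 1) (coboundary X R p f) g +
        (-1 : R) ^ p • cupCochain (by omega : p + (q + 1) = n + 1) f (coboundary X R q g) := by
  subst h
  ext σ
  -- the faces that only touch the front, and those that only touch the back
  have h1 : ∀ i : Fin (p + 1), cupCochain rfl f g (σ.face ⟨i, by omega⟩) =
      f ((σ.pull (frontVertices (by omega : p + 1 ≤ p + q + 1))).face i.castSucc) *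
        g (σ.pull (backVertices (by omega : q ≤ p + q + 1))) := by
    intro i
    simp only [cupCochain, Simplex.face, Simplex.pull_pull]
    congr 3
    · funext j
      ext
      simp only [frontVertices, Function.comp_apply, Fin.succAbove, Fin.lt_def, Fin.val_castLE,
        Fin.val_castSucc]
      split_ifs <;> simp
    · funext j
      ext
      simp only [backVertices, Function.comp_apply, Fin.succAbove, Fin.lt_def, Fin.val_castSucc]
      split_ifs <;> simp <;> omega
  have h2 : ∀ i : Fin (q + 1), cupCochain rfl f g (σ.face ⟨p + 1 + i, by omega⟩) =
      f (σ.pull (frontVertices (by omega : p ≤ p + q + 1))) *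
        g ((σ.pull (backVertices (by omega : q + 1 ≤ p + q + 1))).face i.succ) := by
    intro i
    simp only [cupCochain, Simplex.face, Simplex.pull_pull]
    congr 3
    · funext j
      ext
      simp only [frontVertices, Function.comp_apply, Fin.succAbove, Fin.lt_def, Fin.val_castLE,
        Fin.val_castSucc]
      split_ifs <;> simp <;> omega
    · funext j
      ext
      simp only [backVertices, Function.comp_apply, Fin.succAbove, Fin.lt_def, Fin.val_castSucc,
        Fin.val_succ]
      split_ifs <;> simp <;> omega
  have h3 : (σ.pull (frontVertices (by omega : p + 1 ≤ p + q + 1))).face (Fin.last (p + 1)) =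
      σ.pull (frontVertices (by omega : p ≤ p + q + 1)) := by
    simp only [Simplex.face, Simplex.pull_pull]
    congr 1
    funext j
    ext
    simp [frontVertices]
  have h4 : (σ.pull (backVertices (by omega : q + 1 ≤ p + q + 1))).face 0 =
      σ.pull (backVertices (by omega : q ≤ p + q + 1)) := by
    simp only [Simplex.face, Simplex.pull_pull]
    congr 1
    funext j
    ext
    simp [backVertices]
    omega
  have hL : coboundary X R (p + q) (cupCochain rfl f g) σ =
      ∑ i : Fin (p + 1), (-1 : R) ^ (i : ℕ) * cupCochain rfl f g (σ.face ⟨i, by omega⟩) +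
      ∑ i : Fin (q + 1), (-1 : R) ^ (p + 1 + (i : ℕ)) *
        cupCochain rfl f g (σ.face ⟨p + 1 + i, by omega⟩) := by
    have e : (p + 1) + (q + 1) = p + q + 2 := by omega
    change ∑ i : Fin (p + q + 2), _ = _
    rw [← Equiv.sum_comp (finCongr e), Fin.sum_univ_add]
    rfl
  rw [hL]
  simp only [h1, h2]
  simp only [Pi.add_apply, Pi.smul_apply, smul_eq_mul, cupCochain]
  have hA : coboundary X R p f (σ.pull (frontVertices (by omega : p + 1 ≤ p + q + 1))) =
      ∑ i : Fin (p + 1), (-1 : R) ^ (i : ℕ) *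
        f ((σ.pull (frontVertices (by omega : p + 1 ≤ p + q + 1))).face i.castSucc) +
      (-1 : R) ^ (p + 1) * f (σ.pull (frontVertices (by omega : p ≤ p + q + 1))) := by
    rw [← h3]
    exact Fin.sum_univ_castSucc _
  have hB : coboundary X R q g (σ.pull (backVertices (by omega : q + 1 ≤ p + q + 1))) =
      g (σ.pull (backVertices (by omega : q ≤ p + q + 1))) +
      ∑ i : Fin (q + 1), (-1 : R) ^ ((i : ℕ) + 1) *
        g ((σ.pull (backVertices (by omega : q + 1 ≤ p + q + 1))).face i.succ) := by
    rw [← h4]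
    refine (Fin.sum_univ_succ _).trans ?_
    simp
  rw [hA, hB, add_mul, mul_add, mul_add, Finset.sum_mul, Finset.mul_sum, Finset.mul_sum]
  have e1 : ∀ a b c : R, a * (b * c) = a * b * c := fun a b c => (mul_assoc a b c).symm
  have e2 : ∀ (i : Fin (q + 1)) (a b : R), (-1 : R) ^ (p + 1 + (i : ℕ)) * (a * b) =
      (-1 : R) ^ p * (a * ((-1 : R) ^ ((i : ℕ) + 1) * b)) := by
    intro i a b
    ring
  simp only [e1]
  simp only [← e1, e2]
  ring

theorem cup_mem_cocycles {p q : ℕ} (f : cocycles X R p) (g : cocycles X R q) :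
    cupCochain (rfl : p + q = p + q) f.1 g.1 ∈ cocycles X R (p + q) := by
  have hf : coboundary X R p f.1 = 0 := f.2
  have hg : coboundary X R q g.1 = 0 := g.2
  rw [cocycles, LinearMap.mem_ker, coboundary_cupCochain, hf, hg]
  ext σ
  simp [cupCochain]

theorem cup_mem_left {p q n : ℕ} (h : p + q = n) (f : cocycles X R p) (g : cocycles X R q)
    (hf : f.1 ∈ coboundaries X R p) : cupCochain h f.1 g.1 ∈ coboundaries X R n := by
  have hg : coboundary X R q g.1 = 0 := g.2
  cases p with
  | zero =>
    have h0 : f.1 = 0 := hf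
    have : cupCochain h f.1 g.1 = 0 := by
      rw [h0]
      ext σ
      simp [cupCochain]
    rw [this]
    exact Submodule.zero_mem _
  | succ p =>
    obtain ⟨k, hk⟩ := hf
    obtain rfl : n = (p + q) + 1 := by omega
    refine ⟨cupCochain rfl k g.1, ?_⟩
    rw [coboundary_cupCochain, hk, hg]
    ext σ
    simp [cupCochain]

theorem cup_mem_right {p q n : ℕ} (h : p + q = n) (f : cocycles X R p) (g : cocycles X R q)
    (hg : g.1 ∈ coboundaries X R q) : cupCochain h f.1 g.1 ∈ coboundaries X R n := by
  have hf : coboundary X R p f.1 = 0 := f.2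
  cases q with
  | zero =>
    have h0 : g.1 = 0 := hg
    have : cupCochain h f.1 g.1 = 0 := by
      rw [h0]
      ext σ
      simp [cupCochain]
    rw [this]
    exact Submodule.zero_mem _
  | succ q =>
    obtain ⟨k, hk⟩ := hg
    obtain rfl : n = (p + q) + 1 := by omega
    refine ⟨cupCochain rfl ((-1 : R) ^ p • f.1) k, ?_⟩
    rw [coboundary_cupCochain, hk, map_smul, hf]
    ext σ
    have : (-1 : R) ^ p * (-1 : R) ^ p = 1 := by rw [← mul_pow]; simp
    simp [cupCochain, ← mul_assoc, this]

variable (X R) in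
/-- The class of the cup product of two cocycles, as a bilinear map. -/
def cupCocycles (p q : ℕ) :
    cocycles X R p →ₗ[R] cocycles X R q →ₗ[R] Cohomology X R (p + q) :=
  LinearMap.mk₂ R
    (fun f g => Submodule.Quotient.mk ⟨cupCochain rfl f.1 g.1, cup_mem_cocycles f g⟩)
    (fun f f' g => by
      rw [← Submodule.Quotient.mk_add]
      congr 1
      ext σ
      simp [cupCochain, add_mul])
    (fun c f g => by
      rw [← Submodule.Quotient.mk_smul]
      congr 1
      ext σ
      simp [cupCochain, mul_assoc])
    (fun f g g' => by
      rw [← Submodule.Quotient.mk_add]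
      congr 1
      ext σ
      simp [cupCochain, mul_add])
    (fun c f g => by
      rw [← Submodule.Quotient.mk_smul]
      congr 1
      ext σ
      simp [cupCochain, mul_left_comm])

variable (X R) in
/-- The cup product `H^p(X; R) × H^q(X; R) → H^{p+q}(X; R)`, as a bilinear map. -/
def cupHom (p q : ℕ) : Cohomology X R p →ₗ[R] Cohomology X R q →ₗ[R] Cohomology X R (p + q) :=
  Submodule.liftQ _
    ((Submodule.liftQ _ (cupCocycles X R p q).flip (by
      intro g hg
      rw [LinearMap.mem_ker]
      ext f
      exact (Submodule.Quotient.mk_eq_zero _).2 (cup_mem_right rfl f g hg))).flip) (by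
    intro f hf
    rw [LinearMap.mem_ker]
    ext g
    exact (Submodule.Quotient.mk_eq_zero _).2 (cup_mem_left rfl f g hf))

/-- The cup product of two cohomology classes. -/
def cup {p q : ℕ} (u : Cohomology X R p) (v : Cohomology X R q) : Cohomology X R (p + q) :=
  cupHom X R p q u v

theorem cup_mk {p q : ℕ} (f : cocycles X R p) (g : cocycles X R q) :
    cup (Submodule.Quotient.mk f : Cohomology X R p) (Submodule.Quotient.mk g : Cohomology X R q) =
      Submodule.Quotient.mk ⟨cupCochain rfl f.1 g.1, cup_mem_cocycles f g⟩ :=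
  rfl

variable (X R) in
/-- The unit class `1 ∈ H^0(X; R)`, represented by the constant cochain `1`. -/
def unitClass : Cohomology X R 0 :=
  Submodule.Quotient.mk ⟨fun _ => 1, by
    rw [cocycles, LinearMap.mem_ker]
    ext σ
    simp [coboundary, Fin.sum_univ_succ]⟩

variable {Y : Type u} [TopologicalSpace Y]

/-- Pull-back of cochains along a continuous map. -/
def pullCochain (φ : C(Y, X)) (n : ℕ) : Cochain X R n →ₗ[R] Cochain Y R n where
  toFun f σ := f (φ.comp σ)
  map_add' _ _ := rfl
  map_smul' _ _ := rfl

theorem coboundary_pullCochain (φ : C(Y, X)) (n : ℕ) (f : Cochain X R n) :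
    coboundary Y R n (pullCochain φ n f) = pullCochain φ (n + 1) (coboundary X R n f) :=
  rfl

theorem pullCochain_mem_cocycles (φ : C(Y, X)) (n : ℕ) (f : Cochain X R n)
    (hf : f ∈ cocycles X R n) : pullCochain φ n f ∈ cocycles Y R n := by
  have hf' : coboundary X R n f = 0 := hf
  rw [cocycles, LinearMap.mem_ker, coboundary_pullCochain, hf', map_zero]

theorem pullCochain_mem_coboundaries (φ : C(Y, X)) (n : ℕ) (f : Cochain X R n)
    (hf : f ∈ coboundaries X R n) : pullCochain φ n f ∈ coboundaries Y R n := by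
  cases n with
  | zero =>
    have h0 : f = 0 := hf
    rw [h0, map_zero]
    exact Submodule.zero_mem _
  | succ n =>
    obtain ⟨k, rfl⟩ := hf
    exact ⟨pullCochain φ n k, rfl⟩

variable (R) in
/-- The homomorphism `φ^* : H^n(X; R) → H^n(Y; R)` induced by a continuous map `φ : Y → X`. -/
def cohomologyMap (φ : C(Y, X)) (n : ℕ) : Cohomology X R n →ₗ[R] Cohomology Y R n :=
  Submodule.mapQ _ _
    ((pullCochain φ n).restrict (pullCochain_mem_cocycles φ n))
    (fun f hf => pullCochain_mem_coboundaries φ n f.1 hf)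

/-- The inclusion of a subset, as a continuous map. -/
def inclusion (A : Set X) : C(A, X) := ⟨Subtype.val, continuous_subtype_val⟩

/-- The restriction `u|_A` of a cohomology class to a subset. -/
def restrict {n : ℕ} (u : Cohomology X R n) (A : Set X) : Cohomology A R n :=
  cohomologyMap R (inclusion A) n u

end Cohomology

/-! ### Spaces of the homotopy type of a CW complex -/

/-- `X` has the homotopy type of a CW complex: it is homotopy equivalent to a Hausdorff space `K`
that carries the structure of a CW complex. -/
def HasCWHomotopyType (X : Type u) [TopologicalSpace X] : Prop :=
  ∃ (K : Type u) (_ : TopologicalSpace K) (_ : T2Space K),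
    Nonempty (Topology.CWComplex (Set.univ : Set K)) ∧ Nonempty (ContinuousMap.HomotopyEquiv X K)

/-! ### Category and category weight -/

section Category

variable {X : Type u} [TopologicalSpace X]

/-- `A` is categorical in `X`: the inclusion of `A` in `X` is null-homotopic. -/
def IsCategorical (A : Set X) : Prop := (inclusion A).Nullhomotopic

/-- The Lusternik–Schnirelmann category (non-normalized) of a subset `A` in `X`: the least number of
open subsets of `X`, categorical in `X`, that cover `A`; it is `⊤` if there is no finite such
cover. -/
def cat (A : Set X) : ℕ∞ :=
  ⨅ (k : ℕ) (_ : ∃ U : Fin k → Set X,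
    (∀ i, IsOpen (U i)) ∧ (∀ i, IsCategorical (U i)) ∧ A ⊆ ⋃ i, U i), (k : ℕ∞)

variable {R : Type v} [CommRing R]

/-- The category weight of a cohomology class `u`: the greatest `k` such that `u|_A = 0` for every
closed subset `A` of `X` with `cat A ≤ k` (`⊤` if there is no greatest such `k`). -/
def cwgt {n : ℕ} (u : Cohomology X R n) : ℕ∞ :=
  ⨆ (k : ℕ) (_ : ∀ A : Set X, IsClosed A → cat A ≤ (k : ℕ∞) → restrict u A = 0), (k : ℕ∞)

end Category

/-! ### Good covers and the strict covering type -/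

section Covers

variable {X : Type u} [TopologicalSpace X]

/-- An open cover is good if all its members and all their non-empty finite intersections are
contractible. -/
structure IsGoodCover (𝒰 : Set (Set X)) : Prop where
  isOpen : ∀ U ∈ 𝒰, IsOpen U
  covers : ⋃₀ 𝒰 = Set.univ
  contractible : ∀ U ∈ 𝒰, ContractibleSpace U
  contractible_inter : ∀ F : Set (Set X), F ⊆ 𝒰 → F.Finite → F.Nonempty → (⋂₀ F).Nonempty →
    ContractibleSpace (⋂₀ F)

variable (X) in
/-- The strict covering type: the least cardinality of a good cover of `X` (`⊤` if `X` has no finite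
good cover). -/
def sct : ℕ∞ := ⨅ (𝒰 : Set (Set X)) (_ : IsGoodCover 𝒰), 𝒰.encard

end Covers

/-! ### Weight estimators -/

section Weights

variable (X : Type u) [TopologicalSpace X] (R : Type v) [CommRing R]

/-- A homogeneous class of positive degree. For a path-connected space `X` the reduced cohomology
vanishes in degree `0` and agrees with `H^q(X; R)` for `q ≥ 1`, so every non-zero homogeneous
element of the reduced cohomology ring is of this form. -/
structure HomogeneousClass where
  /-- the degree `|u|` -/
  deg : ℕ
  one_le_deg : 1 ≤ deg
  /-- the class itself -/
  cls : Cohomology X R deg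

/-- A weight estimator: it assigns to every non-zero homogeneous class `u` a positive integer that
is at most `cwgt u`. (Its values at zero classes are irrelevant.) -/
structure WeightEstimator where
  weight : HomogeneousClass X R → ℕ
  one_le : ∀ u, u.cls ≠ 0 → 1 ≤ weight u
  le_cwgt : ∀ u, u.cls ≠ 0 → (weight u : ℕ∞) ≤ cwgt u.cls

variable {X R}

/-- The sum of the degrees of the members of a sequence. -/
def degSum : List (HomogeneousClass X R) → ℕ
  | [] => 0
  | u :: s => u.deg + degSum s

/-- The product `u₁ ⋯ uₙ` of a sequence `(u₁, …, uₙ)`; it is `1` for the empty sequence. -/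
def product : (s : List (HomogeneousClass X R)) → Cohomology X R (degSum s)
  | [] => unitClass X R
  | u :: s => cup u.cls (product s)

/-- The dimension of the product of a sequence, with the convention that it is `-1` for the empty
sequence. -/
def dim : List (HomogeneousClass X R) → ℤ
  | [] => -1
  | u :: s => (degSum (u :: s) : ℤ)

/-- The weight of a sequence: the sum of the weights of its members. -/
def WeightEstimator.weightSum (w : WeightEstimator X R) (s : List (HomogeneousClass X R)) : ℕ :=
  (s.map w.weight).sum

/-- The dimensions of (products of) subsequences of `s` of weight at most `k`; a subsequence of `s`
is a list that is a sublist of `s` up to a permutation. -/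
def dimSet (w : WeightEstimator X R) (s : List (HomogeneousClass X R)) (k : ℕ) : Set ℤ :=
  {d | ∃ s' : List (HomogeneousClass X R), s'.Subperm s ∧ w.weightSum s' ≤ k ∧ d = dim s'}

/-- `wct(s; w) = 1 + w(s) + ∑_{k=1}^{w(s)} max {|ŝ'| : s' ≤ s, w(s') ≤ k}`. -/
def wct (w : WeightEstimator X R) (s : List (HomogeneousClass X R)) : ℤ :=
  1 + (w.weightSum s : ℤ) + ∑ k ∈ Finset.Icc 1 (w.weightSum s), sSup (dimSet w s k)

/-- The maxima in the definition of `wct` exist. -/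
theorem isGreatest_dimSet (w : WeightEstimator X R) (s : List (HomogeneousClass X R)) (k : ℕ) :
    IsGreatest (dimSet w s k) (sSup (dimSet w s k)) := by
  have hfin : (dimSet w s k).Finite := by
    refine Set.Finite.subset ((List.finite_toSet s.sublists).image dim) ?_
    rintro d ⟨s', ⟨t, ht, hts⟩, -, rfl⟩
    refine ⟨t, List.mem_sublists.2 hts, ?_⟩
    have h1 : ∀ l : List (HomogeneousClass X R), degSum l = (l.map HomogeneousClass.deg).sum := by
      intro l
      induction l with
      | nil => rfl
      | cons a l ih => simp [degSum, ih]
    have h2 : degSum t = degSum s' := by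
      rw [h1, h1]
      exact (ht.map _).sum_eq
    cases t with
    | nil =>
      rw [List.Perm.nil_eq ht]
    | cons a t =>
      cases s' with
      | nil => exact absurd ht.length_eq (by simp)
      | cons b s' => simp only [dim, h2]
  have hne : (dimSet w s k).Nonempty :=
    ⟨-1, [], List.nil_subperm, by simp [WeightEstimator.weightSum], rfl⟩
  exact ⟨hne.csSup_mem hfin, fun d hd => le_csSup hfin.bddAbove hd⟩

/-- In particular `wct(s; w)` is a positive integer. -/
theorem one_le_wct (w : WeightEstimator X R) (s : List (HomogeneousClass X R)) :
    1 ≤ wct w s := by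
  have h : ∀ k ∈ Finset.Icc 1 (w.weightSum s), (-1 : ℤ) ≤ sSup (dimSet w s k) := fun k _ =>
    (isGreatest_dimSet w s k).2
      ⟨[], List.nil_subperm, by simp [WeightEstimator.weightSum], rfl⟩
  have h' := Finset.sum_le_sum h
  simp at h'
  unfold wct
  linarith

end Weights

end CovType

end

/-! Let W be the weight of `s` and m_k the largest dimension of a subsequence of weight at most k.
From a finite good cover one removes W simplices of its nerve: step j = 0, ..., W - 1 removes 1 +
m_{W-j} members with a common point, and after the last step a member is still left. Hence there are
at least 1 + W + Σ m_k members (`IsGoodCover.exists_remove_simplices`, `IsGoodCover.wct_le_card`).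

The next simplex exists by `IsGoodCover.exists_simplex`. Let `s'` have weight at most W - j, let `t`
consist of the other factors, of total weight at least j, and let V be the union of the remaining
members. If no |s'| + 1 of these meet, a Mayer–Vietoris induction makes the product of `s'` vanish
on V. The union of each removed simplex is essentially categorical, and by the definition of
category weight the factors of `t` together kill j categorical sets. As the cup product of a class
vanishing on P and a class vanishing on Q vanishes on P ∪ Q (`ExactOn.cup`), the product of `s`
would be zero.

Category weight tests closed sets, while X need not be normal; and the union of a simplex is not
claimed to be contractible. Instead such unions have a halo extension property (`IsSolid.union`),
which yields null-homotopies on closed subsets of any K with K × I normal. A CW complex K is of this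
kind (`normalSpace_prod_of_cwComplex`), so the cover is shrunk in K and pulled back to X
(`HasCWHomotopyType.exists_categorical_shrinking`).

The cohomological input rests on one chain homotopy, `prismOperator_coboundary`, built by coning
affine simplices in convex sets. It gives homotopy invariance, the small simplices theorem and
graded commutativity. -/

noncomputable section

namespace CovType

universe u v

/-! ### Cochains on tuples -/

section Tuples

variable {P Q P' Q' : Type*} {R : Type v} [CommRing R]

/-- The (augmented) coboundary of a function on `m`-tuples. -/
def tupleCoboundary {m : ℕ} : ((Fin m → P) → R) →ₗ[R] ((Fin (m + 1) → P) → R) where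
  toFun F v := ∑ i : Fin (m + 1), (-1 : R) ^ (i : ℕ) * F (v ∘ i.succAbove)
  map_add' F G := by
    ext v
    simp [mul_add, Finset.sum_add_distrib]
  map_smul' c F := by
    ext v
    simp [Finset.mul_sum, mul_left_comm]

theorem tupleCoboundary_apply {m : ℕ} (F : (Fin m → P) → R) (v : Fin (m + 1) → P) :
    tupleCoboundary F v = ∑ i : Fin (m + 1), (-1 : R) ^ (i : ℕ) * F (v ∘ i.succAbove) := rfl

theorem tupleCoboundary_tupleCoboundary {m : ℕ} (F : (Fin m → P) → R) :
    tupleCoboundary (tupleCoboundary F) = 0 := by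
  ext v
  have h : tupleCoboundary (tupleCoboundary F) v =
      ∑ x : Fin (m + 2) × Fin (m + 1),
        (-1 : R) ^ ((x.1 : ℕ) + (x.2 : ℕ)) * F (v ∘ (x.1.succAbove ∘ x.2.succAbove)) := by
    rw [Fintype.sum_prod_type]
    simp only [tupleCoboundary_apply, Finset.mul_sum, pow_add, mul_assoc, Function.comp_assoc]
  rw [h]
  cases m with
  | zero => simp [Fintype.sum_prod_type, Fin.sum_univ_succ, Subsingleton.elim _ (Fin.elim0 : Fin 0 → P)]
  | succ m =>
  refine Finset.sum_involution (fun x _ => (x.1.succAbove x.2, x.2.predAbove x.1)) ?_ ?_ ?_ ?_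
  · rintro ⟨i, j⟩ -
    have e : (i.succAbove j).succAbove ∘ (j.predAbove i).succAbove =
        i.succAbove ∘ j.succAbove := by
      funext l
      simp [Fin.succAbove_succAbove_succAbove_predAbove]
    simp only [e, Fin.neg_one_pow_succAbove_add_predAbove]
    ring
  · rintro ⟨i, j⟩ - - hij
    exact Fin.succAbove_ne i j (congrArg Prod.fst hij)
  · simp
  · rintro ⟨i, j⟩ -
    simp [Fin.succAbove_succAbove_predAbove, Fin.predAbove_predAbove_succAbove]

/-- Evaluation on cones with apex `b`. -/
def coneEval {m : ℕ} (b : P) : ((Fin (m + 1) → P) → R) →ₗ[R] ((Fin m → P) → R) where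
  toFun F w := F (Fin.cons b w)
  map_add' _ _ := rfl
  map_smul' _ _ := rfl

theorem coneEval_apply {m : ℕ} (b : P) (F : (Fin (m + 1) → P) → R) (w : Fin m → P) :
    coneEval b F w = F (Fin.cons b w) := rfl

theorem cons_comp_succAbove_succ {m : ℕ} (b : P) (w : Fin (m + 1) → P) (i : Fin (m + 1)) :
    (Fin.cons b w : Fin (m + 2) → P) ∘ i.succ.succAbove =
      Fin.cons b (w ∘ i.succAbove) := by
  funext j
  refine Fin.cases ?_ (fun j => ?_) j <;> simp

theorem coneEval_tupleCoboundary_zero (b : P) (F : (Fin 0 → P) → R) :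
    coneEval b (tupleCoboundary F) = F := by
  ext w
  simp [coneEval_apply, tupleCoboundary_apply, Subsingleton.elim _ w]

/-- Face 0 of a cone is its base; the other faces are the cones over the faces of the base, with one
more sign. So coning contracts the augmented complex of tuples, in which 0-tuples form degree -1. -/
theorem coneEval_tupleCoboundary {m : ℕ} (b : P) (F : (Fin (m + 1) → P) → R) :
    coneEval b (tupleCoboundary F) = F - tupleCoboundary (coneEval b F) := by
  ext w
  have h0 : (Fin.cons b w : Fin (m + 2) → P) ∘ Fin.succ = w := by
    funext j
    simp
  simp only [coneEval_apply, tupleCoboundary_apply, Pi.sub_apply]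
  rw [Fin.sum_univ_succ]
  simp only [cons_comp_succAbove_succ, Fin.val_zero, pow_zero, one_mul, Fin.val_succ, pow_succ,
    Fin.succAbove_zero, h0]
  simp [Finset.sum_neg_distrib, sub_eq_add_neg]

/-- The subdivision operator dual to `Sd v = b(v) ⬝ Sd (∂ v)`. -/
def tupleSd (b : ∀ m, (Fin (m + 1) → P) → P) :
    (m : ℕ) → ((Fin m → P) → R) →ₗ[R] ((Fin m → P) → R)
  | 0 => LinearMap.id
  | m + 1 =>
    { toFun := fun F v => ∑ i : Fin (m + 1), (-1 : R) ^ (i : ℕ) *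
        tupleSd b m (coneEval (b m v) F) (v ∘ i.succAbove)
      map_add' := fun F G => by
        ext v
        simp [mul_add, Finset.sum_add_distrib]
      map_smul' := fun c F => by
        ext v
        simp [Finset.mul_sum, mul_left_comm] }

/-- The apex depends on `v`, but for fixed `v` the sum is an honest coboundary of a cochain with a
fixed apex, so the cone identity applies to it. -/
theorem tupleSd_succ (b : ∀ m, (Fin (m + 1) → P) → P) (m : ℕ) (F : (Fin (m + 1) → P) → R)
    (v : Fin (m + 1) → P) :
    tupleSd b (m + 1) F v = tupleCoboundary (tupleSd b m (coneEval (b m v) F)) v := rfl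

theorem tupleSd_tupleCoboundary (b : ∀ m, (Fin (m + 1) → P) → P) (m : ℕ)
    (F : (Fin m → P) → R) :
    tupleSd b (m + 1) (tupleCoboundary F) = tupleCoboundary (tupleSd b m F) := by
  induction m with
  | zero =>
    ext v
    rw [tupleSd_succ, coneEval_tupleCoboundary_zero]
  | succ m ih =>
    ext v
    rw [tupleSd_succ, coneEval_tupleCoboundary, map_sub, ih, map_sub,
      tupleCoboundary_tupleCoboundary, sub_zero]

/-- The homotopy operator between two operators `α`, `β`, obtained by coning off. -/
def tupleHomotopy (b : ∀ m, (Fin (m + 1) → Q) → P)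
    (α β : ∀ m, ((Fin m → P) → R) →ₗ[R] ((Fin m → Q) → R)) :
    (m : ℕ) → ((Fin (m + 1) → P) → R) →ₗ[R] ((Fin m → Q) → R)
  | 0 => 0
  | m + 1 =>
    { toFun := fun F v => (α (m + 1) - β (m + 1)) (coneEval (b m v) F) v -
        ∑ i : Fin (m + 1), (-1 : R) ^ (i : ℕ) *
          tupleHomotopy b α β m (coneEval (b m v) F) (v ∘ i.succAbove)
      map_add' := fun F G => by
        ext v
        simp [mul_add, Finset.sum_add_distrib]
        ring
      map_smul' := fun c F => by
        ext v
        simp [Finset.mul_sum, mul_left_comm, mul_sub] }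

theorem tupleHomotopy_succ (b : ∀ m, (Fin (m + 1) → Q) → P)
    (α β : ∀ m, ((Fin m → P) → R) →ₗ[R] ((Fin m → Q) → R)) (m : ℕ)
    (F : (Fin (m + 2) → P) → R) (v : Fin (m + 1) → Q) :
    tupleHomotopy b α β (m + 1) F v = (α (m + 1) - β (m + 1)) (coneEval (b m v) F) v -
      tupleCoboundary (tupleHomotopy b α β m (coneEval (b m v) F)) v := rfl

/-- The acyclic models argument, dualized. The cone identity expands the term with δF, and the
induction hypothesis for the cone of `F` cancels everything but the difference of the operators.
Agreement on 0-tuples, `h0`, starts the induction. -/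
theorem tupleHomotopy_tupleCoboundary (b : ∀ m, (Fin (m + 1) → Q) → P)
    (α β : ∀ m, ((Fin m → P) → R) →ₗ[R] ((Fin m → Q) → R))
    (hα : ∀ m F, α (m + 1) (tupleCoboundary F) = tupleCoboundary (α m F))
    (hβ : ∀ m F, β (m + 1) (tupleCoboundary F) = tupleCoboundary (β m F))
    (h0 : α 0 = β 0) (m : ℕ) (F : (Fin (m + 1) → P) → R) :
    tupleHomotopy b α β (m + 1) (tupleCoboundary F) +
      tupleCoboundary (tupleHomotopy b α β m F) = α (m + 1) F - β (m + 1) F := by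
  have hαβ : ∀ m (F : (Fin m → P) → R), (α (m + 1) - β (m + 1)) (tupleCoboundary F) =
      tupleCoboundary ((α m - β m) F) := by
    intro m F
    simp only [LinearMap.sub_apply, hα, hβ, map_sub]
  induction m with
  | zero =>
    ext v
    rw [Pi.add_apply, tupleHomotopy_succ, coneEval_tupleCoboundary, map_sub, hαβ, h0, sub_self]
    simp [tupleHomotopy]
  | succ m ih =>
    ext v
    rw [Pi.add_apply, tupleHomotopy_succ, coneEval_tupleCoboundary, map_sub, hαβ, map_sub,
      eq_sub_of_add_eq (ih (coneEval (b (m + 1) v) F))]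
    simp only [map_sub, tupleCoboundary_tupleCoboundary, LinearMap.sub_apply, Pi.sub_apply,
      Pi.zero_apply]
    ring

theorem comp_fin_cons (φ : P → P') {m : ℕ} (a : P) (w : Fin m → P) :
    φ ∘ (Fin.cons a w : Fin (m + 1) → P) = Fin.cons (φ a) (φ ∘ w) := by
  funext j
  refine Fin.cases ?_ (fun j => ?_) j <;> simp

/-- Pull-back of functions on tuples. -/
def tuplePull (φ : P → P') {m : ℕ} (F : (Fin m → P') → R) : (Fin m → P) → R := fun w => F (φ ∘ w)

theorem tuplePull_coneEval (φ : P → P') {m : ℕ} (a : P) (F : (Fin (m + 1) → P') → R) :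
    tuplePull φ (coneEval (φ a) F) = coneEval a (tuplePull φ F) := by
  ext w
  simp [tuplePull, coneEval_apply, comp_fin_cons]

theorem tuplePull_tupleSd (b : ∀ m, (Fin (m + 1) → P) → P) (b' : ∀ m, (Fin (m + 1) → P') → P')
    (φ : P → P') (hφ : ∀ m w, b' m (φ ∘ w) = φ (b m w)) (m : ℕ) (F : (Fin m → P') → R) :
    tuplePull φ (tupleSd b' m F) = tupleSd b m (tuplePull φ F) := by
  induction m with
  | zero => rfl
  | succ m ih =>
    ext v
    change tupleSd b' (m + 1) F (φ ∘ v) = _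
    rw [tupleSd_succ, tupleSd_succ, hφ, ← tuplePull_coneEval, ← ih]
    rfl

/-- Naturality needs only that the apexes are chosen naturally; it is what lets the tuple homotopy
descend to singular cochains. -/
theorem tuplePull_tupleHomotopy (b : ∀ m, (Fin (m + 1) → Q) → P)
    (b' : ∀ m, (Fin (m + 1) → Q') → P')
    (α β : ∀ m, ((Fin m → P) → R) →ₗ[R] ((Fin m → Q) → R))
    (α' β' : ∀ m, ((Fin m → P') → R) →ₗ[R] ((Fin m → Q') → R))
    (φ : P → P') (ψ : Q → Q') (hφ : ∀ m w, b' m (ψ ∘ w) = φ (b m w))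
    (hα : ∀ m F, tuplePull ψ (α' m F) = α m (tuplePull φ F))
    (hβ : ∀ m F, tuplePull ψ (β' m F) = β m (tuplePull φ F)) (m : ℕ)
    (F : (Fin (m + 1) → P') → R) :
    tuplePull ψ (tupleHomotopy b' α' β' m F) = tupleHomotopy b α β m (tuplePull φ F) := by
  induction m with
  | zero => rfl
  | succ m ih =>
    ext v
    change tupleHomotopy b' α' β' (m + 1) F (ψ ∘ v) = _
    rw [tupleHomotopy_succ, tupleHomotopy_succ, hφ, ← tuplePull_coneEval, ← ih,
      LinearMap.sub_apply, LinearMap.sub_apply, ← hα, ← hβ]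
    rfl

/-- The sign of the reversal of an `m`-tuple. -/
def reverseSign (R : Type v) [CommRing R] : ℕ → R
  | 0 => 1
  | m + 1 => (-1) ^ m * reverseSign R m

/-- The operator dual to the signed reversal of tuples. -/
def tupleReverse (m : ℕ) : ((Fin m → P) → R) →ₗ[R] ((Fin m → P) → R) where
  toFun F v := reverseSign R m * F (v ∘ Fin.rev)
  map_add' _ _ := by
    ext v
    simp [mul_add]
  map_smul' _ _ := by
    ext v
    simp [mul_left_comm]

/-- Reversal turns face i into face m - i. The resulting sign (-1)^m is exactly the ratio of
consecutive values of `reverseSign`. -/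
theorem tupleReverse_tupleCoboundary (m : ℕ) (F : (Fin m → P) → R) :
    tupleReverse (m + 1) (tupleCoboundary F) = tupleCoboundary (tupleReverse m F) := by
  ext v
  change reverseSign R (m + 1) * ∑ i : Fin (m + 1), _ =
    ∑ i : Fin (m + 1), (-1 : R) ^ (i : ℕ) * (reverseSign R m * F ((v ∘ i.succAbove) ∘ Fin.rev))
  rw [Finset.mul_sum, ← Equiv.sum_comp Fin.revPerm]
  refine Finset.sum_congr rfl fun i _ => ?_
  have h1 : (v ∘ Fin.rev) ∘ (Fin.revPerm i).succAbove = (v ∘ i.succAbove) ∘ Fin.rev := by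
    funext j
    simp [Fin.rev_succAbove]
  have h2 : (-1 : R) ^ m * (-1) ^ ((Fin.revPerm i : Fin (m + 1)) : ℕ) = (-1) ^ (i : ℕ) := by
    rw [← pow_add]
    have : m + ((Fin.revPerm i : Fin (m + 1)) : ℕ) = 2 * (m - i) + i := by
      simp [Fin.val_rev]
      omega
    rw [this, pow_add, pow_mul]
    simp
  rw [h1, reverseSign, ← h2]
  ring

end Tuples

/-! ### Affine simplices in convex sets -/

section Affine

variable {E : Type*} [NormedAddCommGroup E] [NormedSpace ℝ E] {C : Set E}

/-- The affine simplex spanned by a tuple of points of a convex set. -/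
def affineSimplex (hC : Convex ℝ C) {m : ℕ} (w : Fin (m + 1) → C) :
    C(stdSimplex ℝ (Fin (m + 1)), C) where
  toFun x := ⟨∑ j, x.1 j • (w j : E),
    hC.sum_mem (fun j _ => x.2.1 j) x.2.2 (fun j _ => (w j).2)⟩
  continuous_toFun := by
    refine Continuous.subtype_mk ?_ _
    exact continuous_finsetSum _ fun j _ =>
      ((continuous_apply j).comp continuous_subtype_val).smul continuous_const

theorem affineSimplex_coe (hC : Convex ℝ C) {m : ℕ} (w : Fin (m + 1) → C)
    (x : stdSimplex ℝ (Fin (m + 1))) :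
    (affineSimplex hC w x : E) = ∑ j, x.1 j • (w j : E) := rfl

theorem affineSimplex_map (hC : Convex ℝ C) {m n : ℕ} (w : Fin (n + 1) → C)
    (a : Fin (m + 1) → Fin (n + 1)) (x : stdSimplex ℝ (Fin (m + 1))) :
    affineSimplex hC w (stdSimplex.map a x) = affineSimplex hC (w ∘ a) x := by
  ext
  simp only [affineSimplex_coe, Function.comp_apply]
  have : ∀ j, (stdSimplex.map a x).1 j = ∑ i with a i = j, x.1 i := fun j => by
    change (stdSimplex.map a x) j = _
    rw [stdSimplex.map_coe, FunOnFinite.linearMap_apply_apply]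
    rfl
  simp only [this, Finset.sum_smul]
  rw [← Finset.sum_fiberwise Finset.univ a]
  refine Finset.sum_congr rfl fun j _ => Finset.sum_congr rfl fun i hi => ?_
  rw [(Finset.mem_filter.1 hi).2]

theorem affineSimplex_affineSimplex (hC : Convex ℝ C) {m n : ℕ} (w : Fin (n + 1) → C)
    (t : Fin (m + 1) → stdSimplex ℝ (Fin (n + 1))) (x : stdSimplex ℝ (Fin (m + 1))) :
    affineSimplex hC w (affineSimplex (convex_stdSimplex ℝ _) t x) =
      affineSimplex hC (affineSimplex hC w ∘ t) x := by
  ext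
  simp only [affineSimplex_coe, Function.comp_apply, Finset.sum_apply, Finset.smul_sum,
    Finset.sum_smul, Pi.smul_apply, smul_smul, smul_eq_mul]
  rw [Finset.sum_comm]

theorem affineSimplex_vertex {n : ℕ} (x : stdSimplex ℝ (Fin (n + 1))) :
    affineSimplex (convex_stdSimplex ℝ (Fin (n + 1))) (fun i => stdSimplex.vertex i) x = x := by
  apply Subtype.ext
  funext i
  simp [affineSimplex_coe, Finset.sum_apply, Pi.single_apply]

theorem affineSimplex_apply_vertex (hC : Convex ℝ C) {m : ℕ} (w : Fin (m + 1) → C)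
    (i : Fin (m + 1)) : affineSimplex hC w (stdSimplex.vertex i) = w i := by
  ext
  simp [affineSimplex_coe, Pi.single_apply]

/-- The barycenter of a tuple of points of a convex set. -/
def center (hC : Convex ℝ C) (m : ℕ) (w : Fin (m + 1) → C) : C :=
  affineSimplex hC w stdSimplex.barycenter

theorem center_comp_affineSimplex (hC : Convex ℝ C) {m n : ℕ} (w : Fin (n + 1) → C)
    (t : Fin (m + 1) → stdSimplex ℝ (Fin (n + 1))) :
    center hC m (affineSimplex hC w ∘ t) =
      affineSimplex hC w (center (convex_stdSimplex ℝ _) m t) :=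
  (affineSimplex_affineSimplex hC w t _).symm

theorem map_eq_affineSimplex {m n : ℕ} (a : Fin (m + 1) → Fin (n + 1))
    (x : stdSimplex ℝ (Fin (m + 1))) :
    stdSimplex.map a x = affineSimplex (convex_stdSimplex ℝ (Fin (n + 1)))
      (fun i => stdSimplex.vertex (a i)) x := by
  rw [← affineSimplex_vertex (stdSimplex.map a x), affineSimplex_map]
  rfl

variable {X : Type u} [TopologicalSpace X] {R : Type v} [CommRing R]

/-- A singular cochain, evaluated on the affine simplices in `C` along a map `C → X`. -/
def tupleEval (hC : Convex ℝ C) (σ : C(C, X)) {m : ℕ} (f : Cochain X R m) :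
    (Fin (m + 1) → C) → R := fun w => f (σ.comp (affineSimplex hC w))

/-- Evaluation on affine simplices is a cochain map, so the algebra of tuples acts on singular
cochains. The index shifts by one: an m-simplex is an (m + 1)-tuple. -/
theorem tupleEval_coboundary (hC : Convex ℝ C) (σ : C(C, X)) {m : ℕ} (f : Cochain X R m) :
    tupleEval hC σ (coboundary X R m f) = tupleCoboundary (tupleEval hC σ f) := by
  ext w
  change ∑ i : Fin (m + 2), (-1 : R) ^ (i : ℕ) * f (Simplex.face (σ.comp (affineSimplex hC w)) i) =
    ∑ i : Fin (m + 2), (-1 : R) ^ (i : ℕ) * f (σ.comp (affineSimplex hC (w ∘ i.succAbove)))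
  refine Finset.sum_congr rfl fun i _ => ?_
  simp only [Simplex.face, Simplex.pull]
  congr 2
  ext x
  simp [affineSimplex_map]

end Affine

/-! ### The homotopy operator on singular cochains -/

section Prism

variable {X Y : Type u} [TopologicalSpace X] [TopologicalSpace Y] {R : Type v} [CommRing R]

set_option linter.unusedSectionVars false

theorem coboundary_apply {n : ℕ} (f : Cochain X R n) (σ : Simplex X (n + 1)) :
    coboundary X R n f σ = ∑ i : Fin (n + 2), (-1 : R) ^ (i : ℕ) * f (σ.face i) := rfl

/-- The vertices of the standard simplex. -/
def vertices (n : ℕ) : Fin (n + 1) → stdSimplex ℝ (Fin (n + 1)) := fun i => stdSimplex.vertex i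

theorem affineSimplex_comp_vertices {E : Type*} [NormedAddCommGroup E] [NormedSpace ℝ E] {C : Set E}
    (hC : Convex ℝ C) {m : ℕ} (w : Fin (m + 1) → C) : affineSimplex hC w ∘ vertices m = w :=
  funext fun i => affineSimplex_apply_vertex hC w i

theorem map_comp_vertices {m n : ℕ} (a : Fin (m + 1) → Fin (n + 1)) :
    (stdSimplex.map a : stdSimplex ℝ (Fin (m + 1)) → stdSimplex ℝ (Fin (n + 1))) ∘ vertices m =
      vertices n ∘ a := by
  funext i
  simp [vertices]

/-- A singular cochain, evaluated on the affine simplices of a standard simplex. -/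
abbrev simplexEval {n : ℕ} (σ : Simplex X n) {m : ℕ} (f : Cochain X R m) :
    (Fin (m + 1) → stdSimplex ℝ (Fin (n + 1))) → R :=
  tupleEval (convex_stdSimplex ℝ (Fin (n + 1))) σ f

theorem simplexEval_vertices {n : ℕ} (σ : Simplex X n) (f : Cochain X R n) :
    simplexEval σ f (vertices n) = f σ := by
  refine congrArg f ?_
  ext x
  simp only [ContinuousMap.comp_apply]
  exact congrArg σ (affineSimplex_vertex x)

theorem simplexEval_pull {l n : ℕ} (σ : Simplex X n) (a : Fin (l + 1) → Fin (n + 1)) {m : ℕ}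
    (f : Cochain X R m) :
    simplexEval (σ.pull a) f = tuplePull (stdSimplex.map a) (simplexEval σ f) := by
  ext w
  refine congrArg f ?_
  ext x
  refine congrArg σ ?_
  change stdSimplex.map a _ = affineSimplex _ (stdSimplex.map a ∘ w) x
  have h : stdSimplex.map a = affineSimplex (convex_stdSimplex ℝ (Fin (n + 1)))
      (fun i => stdSimplex.vertex (a i)) := funext (map_eq_affineSimplex a)
  rw [h, affineSimplex_affineSimplex]

theorem center_comp_map {l n m : ℕ} (a : Fin (l + 1) → Fin (n + 1))
    (w : Fin (m + 1) → stdSimplex ℝ (Fin (l + 1))) :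
    center (convex_stdSimplex ℝ (Fin (n + 1))) m (stdSimplex.map a ∘ w) =
      stdSimplex.map a (center (convex_stdSimplex ℝ (Fin (l + 1))) m w) := by
  have h : stdSimplex.map a = affineSimplex (convex_stdSimplex ℝ (Fin (n + 1)))
      (fun i => stdSimplex.vertex (a i)) := funext (map_eq_affineSimplex a)
  rw [h, center_comp_affineSimplex]

/-- The prism over a standard simplex. -/
def prismSet (n : ℕ) : Set ((Fin (n + 1) → ℝ) × ℝ) := stdSimplex ℝ (Fin (n + 1)) ×ˢ Set.Icc 0 1

theorem convex_prismSet (n : ℕ) : Convex ℝ (prismSet n) :=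
  (convex_stdSimplex ℝ _).prod (convex_Icc 0 1)

/-- The horizontal section of the prism at height `t`. -/
def prismSection {n : ℕ} (t : unitInterval) (x : stdSimplex ℝ (Fin (n + 1))) : prismSet n :=
  ⟨(x.1, t.1), x.2, t.2⟩

/-- The map of prisms induced by a map of vertices. -/
def prismMap {m n : ℕ} (a : Fin (m + 1) → Fin (n + 1)) (x : prismSet m) : prismSet n :=
  prismSection ⟨x.1.2, x.2.2⟩ (stdSimplex.map a ⟨x.1.1, x.2.1⟩)

/-- The map from a prism given by a homotopy and a simplex. -/
def prismSimplex (H : C(Y × unitInterval, X)) {n : ℕ} (σ : Simplex Y n) : C(prismSet n, X) where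
  toFun x := H (σ ⟨x.1.1, x.2.1⟩, ⟨x.1.2, x.2.2⟩)
  continuous_toFun := by
    refine H.continuous.comp (Continuous.prodMk (σ.continuous.comp ?_) ?_)
    · exact Continuous.subtype_mk (continuous_fst.comp continuous_subtype_val) _
    · exact Continuous.subtype_mk (continuous_snd.comp continuous_subtype_val) _

theorem affineSimplex_prism {n m : ℕ} (w : Fin (m + 1) → prismSet n)
    (x : stdSimplex ℝ (Fin (m + 1))) :
    ((affineSimplex (convex_prismSet n) w x).1.1 : Fin (n + 1) → ℝ) =
      ∑ j, x.1 j • (w j).1.1 ∧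
    (affineSimplex (convex_prismSet n) w x).1.2 = ∑ j, x.1 j • (w j).1.2 := by
  constructor
  · rw [affineSimplex_coe, Prod.fst_sum]
    rfl
  · rw [affineSimplex_coe, Prod.snd_sum]
    rfl

theorem tuplePull_prismSection (H : C(Y × unitInterval, X)) {n : ℕ} (σ : Simplex Y n)
    (t : unitInterval) {m : ℕ} (f : Cochain X R m) :
    tuplePull (prismSection t) (tupleEval (convex_prismSet n) (prismSimplex H σ) f) =
      simplexEval σ (pullCochain (H.comp ((ContinuousMap.id Y).prodMk (.const Y t))) m f) := by
  ext w
  refine congrArg f ?_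
  ext x
  obtain ⟨h1, h2⟩ := affineSimplex_prism (prismSection t ∘ w) x
  refine congrArg H (Prod.ext (congrArg σ (Subtype.ext (h1.trans rfl)))
    (Subtype.ext (h2.trans ?_)))
  simp only [Function.comp_apply, prismSection, smul_eq_mul, ← Finset.sum_mul]
  rw [x.2.2, one_mul]
  rfl

theorem tupleEval_prismSimplex_pull (H : C(Y × unitInterval, X)) {l n : ℕ} (σ : Simplex Y n)
    (a : Fin (l + 1) → Fin (n + 1)) {m : ℕ} (f : Cochain X R m) :
    tupleEval (convex_prismSet l) (prismSimplex H (σ.pull a)) f =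
      tuplePull (prismMap a) (tupleEval (convex_prismSet n) (prismSimplex H σ) f) := by
  ext w
  refine congrArg f ?_
  ext x
  simp only [ContinuousMap.comp_apply, prismSimplex, ContinuousMap.coe_mk, Simplex.pull]
  obtain ⟨h1, h2⟩ := affineSimplex_prism (prismMap a ∘ w) x
  obtain ⟨h3, h4⟩ := affineSimplex_prism w x
  congr 2
  · refine congrArg σ (Subtype.ext ?_)
    change _ = (affineSimplex (convex_prismSet n) (prismMap a ∘ w) x).1.1
    rw [h1, map_eq_affineSimplex]
    change ∑ j, (affineSimplex (convex_prismSet l) w x).1.1 j • _ = _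
    rw [h3]
    simp only [Function.comp_apply, prismMap, prismSection, map_eq_affineSimplex, affineSimplex_coe,
      Finset.sum_apply, Finset.sum_smul, Finset.smul_sum, Pi.smul_apply, smul_smul, smul_eq_mul]
    rw [Finset.sum_comm]
  · refine Subtype.ext ?_
    change _ = (affineSimplex (convex_prismSet n) (prismMap a ∘ w) x).1.2
    rw [h2]
    exact h4

/-- A family of operators on functions on tuples of points of standard simplices, natural for face
maps, that commutes with the coboundary. -/
structure NaturalOperator (R : Type v) [CommRing R] where
  op : ∀ n m, ((Fin m → stdSimplex ℝ (Fin (n + 1))) → R) →ₗ[R]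
    ((Fin m → stdSimplex ℝ (Fin (n + 1))) → R)
  zero_eq : ∀ n, op n 0 = LinearMap.id
  op_coboundary : ∀ n m F, op n (m + 1) (tupleCoboundary F) = tupleCoboundary (op n m F)
  op_pull : ∀ {l n : ℕ} (a : Fin (l + 1) → Fin (n + 1)) m
    (F : (Fin m → stdSimplex ℝ (Fin (n + 1))) → R),
    tuplePull (stdSimplex.map a) (op n m F) = op l m (tuplePull (stdSimplex.map a) F)

/-- The operator on singular cochains induced by a natural operator. -/
def NaturalOperator.onCochain (θ : NaturalOperator R) {m : ℕ} (f : Cochain X R m) :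
    Cochain X R m := fun σ => θ.op m (m + 1) (simplexEval σ f) (vertices m)

/-- The homotopy operator on tuples of points of a prism, between the restriction to the top and
a natural operator on the restriction to the bottom. -/
def prismTuple (θ : NaturalOperator R) (n m : ℕ) : ((Fin (m + 1) → prismSet n) → R) →ₗ[R]
    ((Fin m → stdSimplex ℝ (Fin (n + 1))) → R) :=
  tupleHomotopy
    -- The barycenter, placed in the bottom slice, is an apex that commutes with face maps.
    (fun m w => prismSection 0 (center (convex_stdSimplex ℝ (Fin (n + 1))) m w))
    (fun _ => LinearMap.funLeft R R fun w => prismSection 1 ∘ w)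
    (fun m => (θ.op n m).comp (LinearMap.funLeft R R fun w => prismSection 0 ∘ w)) m

/-- The homotopy operator on singular cochains given by a homotopy of maps and a natural
operator. -/
def prismOperator (H : C(Y × unitInterval, X)) (θ : NaturalOperator R) {n : ℕ}
    (f : Cochain X R (n + 1)) : Cochain Y R n := fun σ =>
  prismTuple θ n (n + 1) (tupleEval (convex_prismSet n) (prismSimplex H σ) f) (vertices n)

theorem prismOperator_eq_zero (H : C(Y × unitInterval, X)) (θ : NaturalOperator R) {n : ℕ}
    (f : Cochain X R (n + 1)) (σ : Simplex Y n)
    (h : tupleEval (convex_prismSet n) (prismSimplex H σ) f = 0) : prismOperator H θ f σ = 0 := by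
  rw [prismOperator, h, map_zero]
  rfl

/-- By naturality the value at a face of `σ` can be computed inside the prism over `σ`; this turns
the singular coboundary of the operator into a tuple coboundary. -/
theorem prismOperator_face (H : C(Y × unitInterval, X)) (θ : NaturalOperator R) {n : ℕ}
    (f : Cochain X R (n + 1)) (σ : Simplex Y (n + 1)) (i : Fin (n + 2)) :
    prismOperator H θ f (σ.face i) =
      prismTuple θ (n + 1) (n + 1) (tupleEval (convex_prismSet (n + 1)) (prismSimplex H σ) f)
        (vertices (n + 1) ∘ i.succAbove) := by
  rw [prismOperator, Simplex.face, tupleEval_prismSimplex_pull, ← map_comp_vertices]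
  refine congrFun (tuplePull_tupleHomotopy _ _ _ _ _ _ (prismMap i.succAbove)
    (stdSimplex.map i.succAbove) ?_ ?_ ?_ _ _).symm (vertices n)
  · intro m w
    rw [center_comp_map]
    rfl
  · intro m F
    rfl
  · intro m F
    exact θ.op_pull _ _ _

/-- The homotopy formula on tuples, read at the vertices of a singular simplex. With θ the identity
it is homotopy invariance; with a constant homotopy it compares θ with the identity. -/
theorem prismOperator_coboundary (H : C(Y × unitInterval, X)) (θ : NaturalOperator R) {n : ℕ}
    (f : Cochain X R (n + 1)) :
    prismOperator H θ (coboundary X R (n + 1) f) + coboundary Y R n (prismOperator H θ f) =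
      pullCochain (H.comp ((ContinuousMap.id Y).prodMk (.const Y 1))) (n + 1) f -
        θ.onCochain
          (pullCochain (H.comp ((ContinuousMap.id Y).prodMk (.const Y 0))) (n + 1) f) := by
  ext σ
  have h1 : coboundary Y R n (prismOperator H θ f) σ =
      tupleCoboundary (prismTuple θ (n + 1) (n + 1)
        (tupleEval (convex_prismSet (n + 1)) (prismSimplex H σ) f)) (vertices (n + 1)) := by
    rw [coboundary_apply, tupleCoboundary_apply]
    exact Finset.sum_congr rfl fun i _ => congrArg _ (prismOperator_face H θ f σ i)
  rw [Pi.add_apply, h1, prismOperator, tupleEval_coboundary, ← Pi.add_apply, prismTuple,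
    prismTuple, tupleHomotopy_tupleCoboundary]
  · rw [Pi.sub_apply, Pi.sub_apply]
    congr 1
    · refine (congrFun (tuplePull_prismSection H σ 1 f) (vertices (n + 1))).trans ?_
      exact simplexEval_vertices _ _
    · change θ.op (n + 1) (n + 2) (tuplePull (prismSection 0)
        (tupleEval (convex_prismSet (n + 1)) (prismSimplex H σ) f)) (vertices (n + 1)) = _
      rw [tuplePull_prismSection]
      rfl
  · intro m F
    rfl
  · intro m F
    exact θ.op_coboundary _ _ (tuplePull (prismSection 0) F)
  -- On 0-tuples both operators are evaluation at the unique empty tuple.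
  · rw [θ.zero_eq]
    exact LinearMap.ext fun F => funext fun w => congrArg F (Subsingleton.elim _ _)

end Prism

/-! ### Small simplices -/

section Small

variable {X Y : Type u} [TopologicalSpace X] [TopologicalSpace Y] {R : Type v} [CommRing R]

/-- The identity operator. -/
def idOp (R : Type v) [CommRing R] : NaturalOperator R where
  op _ _ := LinearMap.id
  zero_eq _ := rfl
  op_coboundary _ _ _ := rfl
  op_pull _ _ _ := rfl

/-- Barycentric subdivision. -/
def sdOp (R : Type v) [CommRing R] : NaturalOperator R where
  op n m := tupleSd (center (convex_stdSimplex ℝ (Fin (n + 1)))) m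
  zero_eq _ := rfl
  op_coboundary _ _ _ := tupleSd_tupleCoboundary _ _ _
  op_pull a m F := tuplePull_tupleSd _ _ _ (fun _ w => center_comp_map a w) m F

/-- Signed reversal of the order of the vertices. -/
def reverseOp (R : Type v) [CommRing R] : NaturalOperator R where
  op _ m := tupleReverse m
  zero_eq _ := by
    refine LinearMap.ext fun F => funext fun w => ?_
    change (1 : R) * F _ = F w
    rw [one_mul]
    exact congrArg F (Subsingleton.elim _ _)
  op_coboundary _ _ _ := tupleReverse_tupleCoboundary _ _
  op_pull _ _ _ := rfl

theorem idOp_onCochain {m : ℕ} (f : Cochain X R m) : (idOp R).onCochain f = f := by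
  ext σ
  exact simplexEval_vertices σ f

theorem NaturalOperator.onCochain_coboundary (θ : NaturalOperator R) {m : ℕ}
    (f : Cochain X R m) :
    θ.onCochain (coboundary X R m f) = coboundary X R m (θ.onCochain f) := by
  ext σ
  rw [NaturalOperator.onCochain, simplexEval, tupleEval_coboundary, θ.op_coboundary, tupleCoboundary_apply,
    coboundary_apply]
  refine Finset.sum_congr rfl fun i _ => congrArg _ ?_
  rw [NaturalOperator.onCochain, Simplex.face, simplexEval_pull, ← θ.op_pull, ← map_comp_vertices]
  rfl

/-- The cochain `f` is zero on all simplices in `S`. -/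
def VanishesOn {n : ℕ} (f : Cochain X R n) (S : Set X) : Prop :=
  ∀ σ : Simplex X n, Set.range σ ⊆ S → f σ = 0

/-- Natural operators and prism operators evaluate a cochain only on affine simplices along the
given map, so vanishing on the simplices of a set survives all of them. -/
theorem VanishesOn.tupleEval_eq_zero {n : ℕ} {f : Cochain X R n} {S : Set X}
    (h : VanishesOn f S) {E : Type*} [NormedAddCommGroup E] [NormedSpace ℝ E] {C : Set E}
    (hC : Convex ℝ C) (σ : C(C, X)) (hσ : Set.range σ ⊆ S) : tupleEval hC σ f = 0 := by
  ext w
  refine h _ ?_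
  rintro _ ⟨x, rfl⟩
  exact hσ ⟨_, rfl⟩

theorem VanishesOn.onCochain {n : ℕ} {f : Cochain X R n} {S : Set X}
    (h : VanishesOn f S) (θ : NaturalOperator R) : VanishesOn (θ.onCochain f) S := by
  intro σ hσ
  rw [NaturalOperator.onCochain, simplexEval, h.tupleEval_eq_zero _ σ hσ, map_zero]
  rfl

theorem VanishesOn.prismOperator {n : ℕ} {f : Cochain X R (n + 1)} {S : Set X} {T : Set Y}
    (h : VanishesOn f S) (H : C(Y × unitInterval, X)) (hH : ∀ y ∈ T, ∀ t, H (y, t) ∈ S)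
    (θ : NaturalOperator R) : VanishesOn (prismOperator H θ f) T := by
  intro σ hσ
  refine prismOperator_eq_zero H θ f σ (h.tupleEval_eq_zero _ _ ?_)
  rintro _ ⟨x, rfl⟩
  exact hH _ (hσ ⟨_, rfl⟩) _

theorem VanishesOn.coboundary {n : ℕ} {f : Cochain X R n} {S : Set X} (h : VanishesOn f S) :
    VanishesOn (CovType.coboundary X R n f) S := by
  intro σ hσ
  rw [coboundary_apply]
  refine Finset.sum_eq_zero fun i _ => ?_
  rw [h, mul_zero]
  rintro _ ⟨x, rfl⟩
  exact hσ ⟨_, rfl⟩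

/-- Affine maps preserve barycenters. Hence subdivision can be iterated inside one fixed convex set,
where distances can be measured. -/
theorem tupleEval_sd {E : Type*} [NormedAddCommGroup E] [NormedSpace ℝ E] {C : Set E}
    (hC : Convex ℝ C) (σ : C(C, X)) {m : ℕ} (f : Cochain X R m) :
    tupleEval hC σ ((sdOp R).onCochain f) = tupleSd (center hC) (m + 1) (tupleEval hC σ f) := by
  ext w
  have h : simplexEval (X := X) (σ.comp (affineSimplex hC w)) f =
      tuplePull (affineSimplex hC w) (tupleEval hC σ f) := by
    ext t
    refine congrArg f ?_
    ext x
    exact congrArg σ (affineSimplex_affineSimplex hC w t x)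
  change tupleSd _ (m + 1) (simplexEval (X := X) (σ.comp (affineSimplex hC w)) f) (vertices m) = _
  rw [h, ← tuplePull_tupleSd (center (convex_stdSimplex ℝ (Fin (m + 1)))) (center hC)
    (affineSimplex hC w) (fun k t => center_comp_affineSimplex hC w t)]
  change tupleSd _ (m + 1) _ (affineSimplex hC w ∘ vertices m) = _
  rw [affineSimplex_comp_vertices]

/-! ### Diameters under iterated barycentric subdivision -/

section Mesh

variable {E : Type*} [NormedAddCommGroup E] [NormedSpace ℝ E] {C : Set E}

theorem affineSimplex_mem_convexHull (hC : Convex ℝ C) {m : ℕ} (w : Fin (m + 1) → C)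
    (x : stdSimplex ℝ (Fin (m + 1))) :
    (affineSimplex hC w x : E) ∈ convexHull ℝ (Set.range fun i => (w i : E)) :=
  (convex_convexHull ℝ _).sum_mem (fun j _ => x.2.1 j) x.2.2
    (fun j _ => subset_convexHull ℝ _ ⟨j, rfl⟩)

/-- The difference of `v l` and the barycenter is the mean of the k + 1 vectors `v l - v i`, one of
which is zero. -/
theorem dist_center_le (hC : Convex ℝ C) {k : ℕ} (v : Fin (k + 1) → C) {r : ℝ}
    (hv : ∀ i j, dist (v i : E) (v j) ≤ r) (l : Fin (k + 1)) :
    dist (v l : E) (center hC k v) ≤ k / (k + 1) * r := by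
  have h0 : (0 : ℝ) < k + 1 := by positivity
  have e : (v l : E) - center hC k v = ∑ i, ((k : ℝ) + 1)⁻¹ • ((v l : E) - v i) := by
    rw [← Finset.smul_sum, Finset.sum_sub_distrib, smul_sub, center, affineSimplex_coe]
    simp only [stdSimplex.barycenter_apply, ← Finset.smul_sum]
    simp only [Fintype.card_fin, Finset.sum_const, Finset.card_univ]
    rw [← Nat.cast_smul_eq_nsmul ℝ, smul_smul]
    push_cast
    rw [inv_mul_cancel₀ h0.ne', one_smul]
  rw [dist_eq_norm, e]
  refine (norm_sum_le _ _).trans ?_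
  rw [← Finset.add_sum_erase _ _ (Finset.mem_univ l)]
  have h1 : ∑ i ∈ Finset.univ.erase l, ‖((k : ℝ) + 1)⁻¹ • ((v l : E) - v i)‖ ≤
      ∑ i ∈ Finset.univ.erase l, ((k : ℝ) + 1)⁻¹ * r := by
    refine Finset.sum_le_sum fun i _ => ?_
    rw [norm_smul, Real.norm_of_nonneg (by positivity), ← dist_eq_norm]
    exact mul_le_mul_of_nonneg_left (hv _ _) (by positivity)
  refine (add_le_add_right h1 _).trans (le_of_eq ?_)
  simp [Finset.card_erase_of_mem]
  ring

/-- The subdivision evaluates `F` only on tuples in the convex hull of `v` whose mesh is smaller by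
the factor `c`. The hull condition is carried along because it bounds the distance from the later
vertices to the apex. -/
theorem tupleSd_eq_zero (hC : Convex ℝ C) {r c : ℝ} (k : ℕ)
    (hr : 0 ≤ r) (hc : ∀ j < k, (j : ℝ) / (j + 1) ≤ c) (F : (Fin k → C) → R) (v : Fin k → C)
    (hv : ∀ i j, dist (v i : E) (v j) ≤ r)
    (hF : ∀ w : Fin k → C, (∀ i, (w i : E) ∈ convexHull ℝ (Set.range fun i => (v i : E))) →
      (∀ i j, dist (w i : E) (w j) ≤ c * r) → F w = 0) :
    tupleSd (center hC) k F v = 0 := by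
  induction k with
  | zero => exact hF v (fun i => i.elim0) (fun i => i.elim0)
  | succ k ih =>
    have hck := hc k (Nat.lt_succ_self k)
    rw [tupleSd_succ, tupleCoboundary_apply]
    refine Finset.sum_eq_zero fun i _ => ?_
    refine mul_eq_zero_of_right _ (ih (fun j hj => hc j (hj.trans (Nat.lt_succ_self k))) _ _
      (fun _ _ => hv _ _) ?_)
    intro w hw hwd
    have hsub : ∀ j, (w j : E) ∈ convexHull ℝ (Set.range fun i => (v i : E)) := fun j =>
      convexHull_mono (by rintro _ ⟨l, rfl⟩; exact ⟨_, rfl⟩) (hw j)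
    -- A ball about the barycenter that contains the vertices contains their hull.
    have hball : ∀ j, dist (w j : E) (center hC k v) ≤ c * r := fun j => by
      refine Metric.mem_closedBall.1 (convexHull_min ?_ (convex_closedBall _ _) (hsub j))
      rintro _ ⟨l, rfl⟩
      exact Metric.mem_closedBall.2 ((dist_center_le hC v hv l).trans
        (mul_le_mul_of_nonneg_right hck hr))
    have hcr : 0 ≤ c * r := mul_nonneg (le_trans (by positivity) hck) hr
    refine hF _ (fun j => ?_) (fun j l => ?_)
    · refine Fin.cases ?_ (fun j => ?_) j
      · exact affineSimplex_mem_convexHull hC v _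
      · simpa using hsub j
    · refine Fin.cases ?_ (fun j => ?_) j <;> refine Fin.cases ?_ (fun l => ?_) l
      · simpa using hcr
      · simpa [dist_comm] using hball l
      · simpa using hball j
      · simpa using hwd j l

/-- Iterated subdivision of a cochain. -/
def iteratedSd {m : ℕ} (f : Cochain X R m) (i : ℕ) : Cochain X R m := (sdOp R).onCochain^[i] f

theorem iteratedSd_succ {m : ℕ} (f : Cochain X R m) (i : ℕ) :
    iteratedSd f (i + 1) = (sdOp R).onCochain (iteratedSd f i) :=
  Function.iterate_succ_apply' _ _ _

theorem tupleEval_iteratedSd_eq_zero (hC : Convex ℝ C) (σ : C(C, X)) {m : ℕ}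
    (f : Cochain X R m) {c : ℝ} (hc0 : 0 ≤ c) (hc : ∀ j < m + 1, (j : ℝ) / (j + 1) ≤ c) (i : ℕ)
    {r : ℝ} (hr : 0 ≤ r)
    (hf : ∀ w : Fin (m + 1) → C, (∀ j l, dist (w j : E) (w l) ≤ c ^ i * r) →
      tupleEval hC σ f w = 0)
    (w : Fin (m + 1) → C) (hw : ∀ i j, dist (w i : E) (w j) ≤ r) :
    tupleEval hC σ (iteratedSd f i) w = 0 := by
  induction i generalizing r w with
  | zero => exact hf w (by simpa using hw)
  | succ i ih =>
    rw [iteratedSd_succ, tupleEval_sd]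
    refine tupleSd_eq_zero hC _ hr hc _ w hw fun w' _ hw' => ?_
    refine ih (mul_nonneg hc0 hr) (fun w'' h => hf w'' ?_) w' hw'
    intro i j
    rw [pow_succ, mul_assoc]
    exact h i j

/-- Below a Lebesgue number of the cover by the preimages of A and B every affine simplex maps into
A or into B, where `f` is zero; each subdivision shrinks the mesh by m / (m + 1) < 1. -/
theorem exists_tupleEval_iteratedSd_eq_zero (hC : Convex ℝ C) (hcpt : IsCompact C) (σ : C(C, X))
    {A B : Set X} (hA : IsOpen A) (hB : IsOpen B) (hσ : Set.range σ ⊆ A ∪ B) {m : ℕ}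
    (f : Cochain X R m) (hfA : VanishesOn f A) (hfB : VanishesOn f B) :
    ∃ N, ∀ i ≥ N, tupleEval hC σ (iteratedSd f i) = 0 := by
  have : CompactSpace C := isCompact_iff_compactSpace.1 hcpt
  obtain ⟨ε, hε, hleb⟩ := lebesgue_number_lemma_of_metric (s := (Set.univ : Set C))
    (c := fun b : Bool => σ ⁻¹' (bif b then A else B)) isCompact_univ
    (by rintro (_ | _)
        · exact hB.preimage σ.continuous
        · exact hA.preimage σ.continuous)
    (by intro x _
        rcases hσ ⟨x, rfl⟩ with h | h
        · exact Set.mem_iUnion.2 ⟨true, h⟩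
        · exact Set.mem_iUnion.2 ⟨false, h⟩)
  have hsmall : ∀ w : Fin (m + 1) → C, (∀ i j, dist (w i : E) (w j) ≤ ε / 2) →
      tupleEval hC σ f w = 0 := by
    intro w hw
    have hx : ∀ x, affineSimplex hC w x ∈ Metric.ball (w 0) ε := by
      intro x
      have : (affineSimplex hC w x : E) ∈ Metric.closedBall (w 0 : E) (ε / 2) :=
        convexHull_min (by rintro _ ⟨l, rfl⟩; exact hw l 0) (convex_closedBall _ _)
          (affineSimplex_mem_convexHull hC w x)
      exact lt_of_le_of_lt (Metric.mem_closedBall.1 this) (half_lt_self hε)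
    obtain ⟨b, hb⟩ := hleb (w 0) trivial
    cases b with
    | true => exact hfA _ (by rintro _ ⟨x, rfl⟩; exact hb (hx x))
    | false => exact hfB _ (by rintro _ ⟨x, rfl⟩; exact hb (hx x))
  obtain ⟨D, hD⟩ := Metric.isBounded_iff.1 hcpt.isBounded
  set c : ℝ := (m : ℝ) / (m + 1) with hc
  have hc0 : 0 ≤ c := by positivity
  have hc1 : c < 1 := by
    rw [hc, div_lt_one (by positivity)]
    linarith
  have hcj : ∀ j < m + 1, (j : ℝ) / (j + 1) ≤ c := by
    intro j hj
    rw [hc, div_le_div_iff₀ (by positivity) (by positivity)]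
    have : (j : ℝ) ≤ m := by exact_mod_cast Nat.lt_succ_iff.1 hj
    linarith
  have hlim : Filter.Tendsto (fun i => c ^ i * max D 0) Filter.atTop (nhds 0) := by
    simpa using (tendsto_pow_atTop_nhds_zero_of_lt_one hc0 hc1).mul_const (max D 0)
  obtain ⟨N, hN⟩ := Filter.eventually_atTop.1 (hlim.eventually (ge_mem_nhds (half_pos hε)))
  refine ⟨N, fun i hi => funext fun w => ?_⟩
  refine tupleEval_iteratedSd_eq_zero hC σ f hc0 hcj i (le_max_right D 0) (fun w hw => ?_) w
    (fun i j => (hD (w i).2 (w j).2).trans (le_max_left _ _))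
  exact hsmall w fun j l => (hw j l).trans (hN i hi)

end Mesh

theorem sub_onCochain_eq (θ : NaturalOperator R) {n : ℕ} (f : Cochain X R (n + 1)) :
    f - θ.onCochain f = prismOperator ContinuousMap.fst θ (coboundary X R (n + 1) f) +
      coboundary X R n (prismOperator ContinuousMap.fst θ f) :=
  (prismOperator_coboundary ContinuousMap.fst θ f).symm

theorem isCompact_prismSet (n : ℕ) : IsCompact (prismSet n) :=
  (isCompact_stdSimplex ℝ (Fin (n + 1))).prod isCompact_Icc

/-- **Small simplices**: a cocycle on `A ∪ B` that is zero on the simplices in `A` and on the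
simplices in `B` is a coboundary on `A ∪ B`. -/
theorem exists_primitive_of_vanishesOn {A B : Set X} (hA : IsOpen A) (hB : IsOpen B) {q : ℕ}
    (f : Cochain X R (q + 1)) (hf : VanishesOn (coboundary X R (q + 1) f) (A ∪ B))
    (hfA : VanishesOn f A) (hfB : VanishesOn f B) :
    ∃ a : Cochain X R q, VanishesOn (f - coboundary X R q a) (A ∪ B) := by
  -- On A ∪ B the coboundary of `T i` is the difference of the i-th and (i + 1)-st subdivisions of
  -- `f`, so the sum of all `T i` telescopes to a primitive of `f`.
  set T : ℕ → Cochain X R q :=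
    fun i => prismOperator ContinuousMap.fst (sdOp R) (iteratedSd f i) with hT
  have hcoc : ∀ i, VanishesOn (coboundary X R (q + 1) (iteratedSd f i)) (A ∪ B) := by
    intro i
    induction i with
    | zero => exact hf
    | succ i ih =>
      rw [iteratedSd_succ, ← NaturalOperator.onCochain_coboundary]
      exact ih.onCochain _
  have hstep : ∀ i (σ : Simplex X (q + 1)), Set.range σ ⊆ A ∪ B →
      iteratedSd f i σ - iteratedSd f (i + 1) σ = coboundary X R q (T i) σ := by
    intro i σ hσ
    have h := congrFun (sub_onCochain_eq (sdOp R) (iteratedSd f i)) σ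
    rw [Pi.add_apply, (hcoc i).prismOperator (T := A ∪ B) _ (fun y hy _ => hy) _ σ hσ,
      zero_add, ← iteratedSd_succ] at h
    exact h
  have hTzero : ∀ τ : Simplex X q, Set.range τ ⊆ A ∪ B → ∃ N, ∀ i ≥ N, T i τ = 0 := by
    intro τ hτ
    obtain ⟨N, hN⟩ := exists_tupleEval_iteratedSd_eq_zero (convex_prismSet q)
      (isCompact_prismSet q) (prismSimplex ContinuousMap.fst τ) hA hB
      (by rintro _ ⟨x, rfl⟩; exact hτ ⟨_, rfl⟩) f hfA hfB
    exact ⟨N, fun i hi => prismOperator_eq_zero _ _ _ _ (hN i hi)⟩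
  -- The number of subdivisions needed depends on the simplex, but on each simplex in A ∪ B the sum
  -- is finite. Elsewhere the value of the `finsum`, possibly its default 0, plays no role.
  refine ⟨fun τ => ∑ᶠ i, T i τ, fun σ hσ => ?_⟩
  have hface : ∀ i, Set.range (σ.face i) ⊆ A ∪ B := by
    rintro i _ ⟨x, rfl⟩
    exact hσ ⟨_, rfl⟩
  choose N hN using fun i => hTzero (σ.face i) (hface i)
  obtain ⟨N', hN'⟩ := exists_tupleEval_iteratedSd_eq_zero (convex_stdSimplex ℝ _)
    (isCompact_stdSimplex ℝ _) σ hA hB hσ f hfA hfB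
  -- One bound that serves `σ` and all its faces.
  set M := N' + ∑ i, N i with hM
  have hMi : ∀ i, N i ≤ M := fun i =>
    (Finset.single_le_sum (fun _ _ => Nat.zero_le _) (Finset.mem_univ i)).trans (Nat.le_add_left _ _)
  have hsum : ∀ i, ∑ᶠ j, T j (σ.face i) = ∑ j ∈ Finset.range M, T j (σ.face i) := by
    intro i
    refine finsum_eq_sum_of_support_subset _ fun j hj => ?_
    rw [Finset.coe_range, Set.mem_Iio]
    by_contra hlt
    exact hj (hN i j ((hMi i).trans (not_lt.1 hlt)))
  have hlast : iteratedSd f M σ = 0 := by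
    rw [← simplexEval_vertices σ (iteratedSd f M), simplexEval, hN' M (Nat.le_add_right _ _)]
    rfl
  rw [Pi.sub_apply, coboundary_apply]
  simp only [hsum, Finset.mul_sum]
  rw [Finset.sum_comm, sub_eq_zero]
  calc f σ = iteratedSd f 0 σ - iteratedSd f M σ := by rw [hlast, sub_zero]; rfl
    _ = ∑ j ∈ Finset.range M, (iteratedSd f j σ - iteratedSd f (j + 1) σ) :=
      (Finset.sum_range_sub' (fun j => iteratedSd f j σ) M).symm
    _ = _ := Finset.sum_congr rfl fun j _ => hstep j σ hσ

end Small

/-! ### Cochains that are exact on a subset -/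

section Exact

variable {X Y : Type u} [TopologicalSpace X] [TopologicalSpace Y] {R : Type v} [CommRing R]

/-- The cochain `f` agrees with a coboundary on the simplices in `S`. -/
def ExactOn {n : ℕ} (f : Cochain X R n) (S : Set X) : Prop :=
  ∃ g ∈ coboundaries X R n, VanishesOn (f - g) S

theorem exactOn_succ_iff {n : ℕ} (f : Cochain X R (n + 1)) (S : Set X) :
    ExactOn f S ↔ ∃ a : Cochain X R n, VanishesOn (f - coboundary X R n a) S :=
  ⟨fun ⟨_, ⟨a, ha⟩, h⟩ => ⟨a, ha ▸ h⟩, fun ⟨a, h⟩ => ⟨_, ⟨a, rfl⟩, h⟩⟩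

theorem VanishesOn.mono {n : ℕ} {f : Cochain X R n} {S T : Set X} (h : VanishesOn f T)
    (hST : S ⊆ T) : VanishesOn f S := fun σ hσ => h σ (hσ.trans hST)

theorem ExactOn.mono {n : ℕ} {f : Cochain X R n} {S T : Set X} (h : ExactOn f T)
    (hST : S ⊆ T) : ExactOn f S :=
  let ⟨g, hg, hv⟩ := h
  ⟨g, hg, hv.mono hST⟩

theorem vanishesOn_empty {n : ℕ} (f : Cochain X R n) : VanishesOn f ∅ := fun _ hσ =>
  (hσ ⟨stdSimplex.vertex 0, rfl⟩).elim

theorem exactOn_empty {n : ℕ} (f : Cochain X R n) : ExactOn f ∅ :=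
  ⟨0, Submodule.zero_mem _, vanishesOn_empty _⟩

theorem exactOn_univ_iff {n : ℕ} (f : Cochain X R n) :
    ExactOn f Set.univ ↔ f ∈ coboundaries X R n := by
  constructor
  · rintro ⟨g, hg, h⟩
    have : f = g := funext fun σ => sub_eq_zero.1 (h σ (Set.subset_univ _))
    exact this ▸ hg
  · exact fun h => ⟨f, h, fun σ _ => sub_self _⟩

theorem ExactOn.of_sub_mem {n : ℕ} {f g : Cochain X R n} {S : Set X} (hg : ExactOn g S)
    (h : f - g ∈ coboundaries X R n) : ExactOn f S := by
  obtain ⟨k, hk, hv⟩ := hg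
  refine ⟨f - g + k, Submodule.add_mem _ h hk, ?_⟩
  have : f - (f - g + k) = g - k := by abel
  rwa [this]

/-- A simplex in `S`, as a simplex of the subspace `S`. -/
def liftSimplex {n : ℕ} (S : Set X) (σ : Simplex X n) (hσ : Set.range σ ⊆ S) : Simplex S n :=
  ⟨fun x => ⟨σ x, hσ ⟨x, rfl⟩⟩, Continuous.subtype_mk σ.continuous _⟩

/-- A primitive on the subspace extends by zero to the simplices not contained in S. This lets all
later arguments use cochains on X only. -/
theorem exactOn_of_pullCochain_mem {n : ℕ} (f : Cochain X R n) (S : Set X)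
    (h : pullCochain (inclusion S) n f ∈ coboundaries S R n) : ExactOn f S := by
  classical
  cases n with
  | zero =>
    refine ⟨0, Submodule.zero_mem _, fun σ hσ => ?_⟩
    have h0 : pullCochain (inclusion S) 0 f = 0 := h
    rw [sub_zero]
    exact congrFun h0 (liftSimplex S σ hσ)
  | succ n =>
    obtain ⟨k, hk⟩ := h
    rw [exactOn_succ_iff]
    refine ⟨fun τ => if hτ : Set.range τ ⊆ S then k (liftSimplex S τ hτ) else 0, fun σ hσ => ?_⟩
    have hface : ∀ i, Set.range (σ.face i) ⊆ S := by
      rintro i _ ⟨x, rfl⟩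
      exact hσ ⟨_, rfl⟩
    rw [Pi.sub_apply, sub_eq_zero, coboundary_apply]
    refine ((congrFun hk (liftSimplex S σ hσ)).symm).trans ?_
    rw [coboundary_apply]
    refine Finset.sum_congr rfl fun i _ => ?_
    rw [dif_pos (hface i)]
    rfl

theorem exactOn_of_restrict_eq_zero {n : ℕ} (f : cocycles X R n) (S : Set X)
    (h : restrict (Submodule.Quotient.mk f : Cohomology X R n) S = 0) : ExactOn f.1 S := by
  refine exactOn_of_pullCochain_mem f.1 S ?_
  have h' : (pullCochain (inclusion S) n).restrict (pullCochain_mem_cocycles (inclusion S) n) f ∈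
    (coboundaries S R n).submoduleOf (cocycles S R n) := (Submodule.Quotient.mk_eq_zero _).1 h
  exact h'

/-- After subtraction of coboundaries `f` is zero on simplices in P and `g` on simplices in Q. The
product is then zero on both kinds of simplices, and the small simplices theorem makes it exact on P
∪ Q. -/
theorem ExactOn.cup {p q n : ℕ} (h : p + q = n) (hp : 1 ≤ p) (f : cocycles X R p)
    (g : cocycles X R q) {P Q : Set X} (hP : IsOpen P) (hQ : IsOpen Q) (hf : ExactOn f.1 P)
    (hg : ExactOn g.1 Q) : ExactOn (cupCochain h f.1 g.1) (P ∪ Q) := by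
  obtain ⟨f₀, hf₀, hfv⟩ := hf
  obtain ⟨g₀, hg₀, hgv⟩ := hg
  set f₁ : cocycles X R p := ⟨f₀, coboundaries_le_cocycles X R p hf₀⟩
  set g₁ : cocycles X R q := ⟨g₀, coboundaries_le_cocycles X R q hg₀⟩
  refine ExactOn.of_sub_mem (g := cupCochain h (f - f₁).1 (g - g₁).1) ?_ ?_
  · have hc : coboundary X R n (cupCochain h (f - f₁).1 (g - g₁).1) = 0 := by
      subst h
      exact cup_mem_cocycles (f - f₁) (g - g₁)
    obtain ⟨n, rfl⟩ : ∃ k, n = k + 1 := ⟨n - 1, by omega⟩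
    rw [exactOn_succ_iff]
    refine exists_primitive_of_vanishesOn hP hQ _ ?_ ?_ ?_
    · rw [hc]
      exact fun _ _ => rfl
    · intro σ hσ
      refine mul_eq_zero_of_left (hfv _ ?_) _
      rintro _ ⟨x, rfl⟩
      exact hσ ⟨_, rfl⟩
    · intro σ hσ
      refine mul_eq_zero_of_right _ (hgv _ ?_)
      rintro _ ⟨x, rfl⟩
      exact hσ ⟨_, rfl⟩
  · have e : cupCochain h f.1 g.1 - cupCochain h (f - f₁).1 (g - g₁).1 =
        cupCochain h f₁.1 g.1 + cupCochain h (f - f₁).1 g₁.1 := by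
      ext σ
      simp [cupCochain]
      ring
    rw [e]
    exact Submodule.add_mem _ (cup_mem_left h f₁ g hf₀) (cup_mem_right h (f - f₁) g₁ hg₀)

/-! ### Homotopy invariance and Mayer–Vietoris -/

/-- Cocycles of positive degree on `S` are exact on `S`. -/
def IsAcyclicSet (R : Type v) [CommRing R] (S : Set X) : Prop :=
  ∀ (q : ℕ) (f : Cochain X R (q + 1)), VanishesOn (coboundary X R (q + 1) f) S → ExactOn f S

/-- The coboundary of a constant cochain is zero in even degrees and the same constant in odd
degrees. A constant cocycle of positive degree is thus either zero or the coboundary of a constant.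
-/
theorem const_mem_coboundaries (q : ℕ) (c : R)
    (hc : (fun _ => c : Cochain X R (q + 1)) ∈ cocycles X R (q + 1)) [Nonempty X] :
    (fun _ => c : Cochain X R (q + 1)) ∈ coboundaries X R (q + 1) := by
  have hsum : ∀ m : ℕ, ∑ i : Fin m, (-1 : R) ^ (i : ℕ) = if Even m then 0 else 1 := by
    intro m
    rw [Fin.sum_univ_eq_sum_range (fun i => (-1 : R) ^ i), neg_one_geom_sum]
  have hδ : ∀ m, coboundary X R m (fun _ => c) = fun _ => if Even m then 0 else c := by
    intro m
    ext σ
    rw [coboundary_apply, ← Finset.sum_mul, hsum]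
    by_cases h : Even m <;> simp [h, parity_simps]
  rcases Nat.even_or_odd q with h | h
  · have h0 := congrFun ((hδ (q + 1)).symm.trans hc) (ContinuousMap.const _ (Classical.arbitrary X))
    have : ¬ Even (q + 1) := by simp [h, parity_simps]
    rw [if_neg this] at h0
    have : (fun _ => c : Cochain X R (q + 1)) = 0 := funext fun _ => h0
    rw [this]
    exact Submodule.zero_mem _
  · refine ⟨fun _ => c, ?_⟩
    rw [hδ, if_neg (Nat.not_even_iff_odd.2 h)]

theorem pullCochain_sub_pullCochain_mem {φ ψ : C(Y, X)} (h : φ.Homotopic ψ) {n : ℕ}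
    (f : Cochain X R (n + 1)) (hf : f ∈ cocycles X R (n + 1)) :
    pullCochain ψ (n + 1) f - pullCochain φ (n + 1) f ∈ coboundaries Y R (n + 1) := by
  obtain ⟨H⟩ := h
  have hf0 : coboundary X R (n + 1) f = 0 := hf
  refine ⟨prismOperator (H.toContinuousMap.comp ContinuousMap.prodSwap) (idOp R) f, ?_⟩
  have e := prismOperator_coboundary (H.toContinuousMap.comp ContinuousMap.prodSwap) (idOp R) f
  have h1 : (H.toContinuousMap.comp ContinuousMap.prodSwap).comp
      ((ContinuousMap.id Y).prodMk (.const Y 1)) = ψ := by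
    ext y
    exact H.map_one_left y
  have h0 : (H.toContinuousMap.comp ContinuousMap.prodSwap).comp
      ((ContinuousMap.id Y).prodMk (.const Y 0)) = φ := by
    ext y
    exact H.map_zero_left y
  rw [idOp_onCochain, h1, h0, hf0] at e
  rw [← e]
  ext σ
  rw [Pi.add_apply, prismOperator_eq_zero, zero_add]
  rfl

/-- The identity of S is homotopic to a constant map, along which a cocycle pulls back to a constant
cochain. -/
theorem isAcyclicSet_of_contractibleSpace (S : Set X) [ContractibleSpace S] :
    IsAcyclicSet R S := by
  intro q f hf
  refine exactOn_of_pullCochain_mem f S ?_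
  have hcoc : pullCochain (inclusion S) (q + 1) f ∈ cocycles S R (q + 1) := by
    change coboundary S R (q + 1) _ = 0
    rw [coboundary_pullCochain]
    ext σ
    refine hf _ ?_
    rintro _ ⟨x, rfl⟩
    exact (σ x).2
  obtain ⟨x, hx⟩ := id_nullhomotopic S
  have h := Submodule.sub_mem _ (const_mem_coboundaries q
    (pullCochain (inclusion S) (q + 1) f (ContinuousMap.const _ x))
    (pullCochain_mem_cocycles (ContinuousMap.const S x) (q + 1) _ hcoc))
    (pullCochain_sub_pullCochain_mem hx _ hcoc)
  have e : ∀ a b c : Cochain S R (q + 1), a = b → a - (b - c) = c := by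
    rintro a b c rfl
    abel
  convert h using 1
  exact (e _ _ _ rfl).symm

/-- Mayer–Vietoris. -/
theorem ExactOn.union {A B : Set X} (hA : IsOpen A) (hB : IsOpen B) {q : ℕ}
    (f : Cochain X R (q + 1)) (hf : VanishesOn (coboundary X R (q + 1) f) (A ∪ B))
    (hfA : ExactOn f A) (hfB : ExactOn f B)
    (hAB : ∀ c : Cochain X R q, VanishesOn (coboundary X R q c) (A ∩ B) → ExactOn c (A ∩ B)) :
    ExactOn f (A ∪ B) := by
  classical
  rw [exactOn_succ_iff] at hfA hfB
  obtain ⟨a, ha⟩ := hfA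
  obtain ⟨b, hb⟩ := hfB
  -- Two primitives of `f` differ by a cocycle on A ∩ B. The correction `g` is a cocycle on all of
  -- X, so `a - g` is still a primitive on A.
  obtain ⟨g, hg, hv⟩ := hAB (a - b) (by
    intro σ hσ
    have h1 := ha σ (hσ.trans Set.inter_subset_left)
    have h2 := hb σ (hσ.trans Set.inter_subset_right)
    rw [map_sub]
    rw [Pi.sub_apply, sub_eq_zero] at h1 h2 ⊢
    rw [← h1, ← h2])
  have hg0 : coboundary X R q g = 0 := coboundaries_le_cocycles X R q hg
  set c : Cochain X R q := fun τ => if Set.range τ ⊆ A then a τ - g τ else b τ with hc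
  have hcA : ∀ τ : Simplex X q, Set.range τ ⊆ A → c τ = (a - g) τ := fun τ hτ => if_pos hτ
  have hcB : ∀ τ : Simplex X q, Set.range τ ⊆ B → c τ = b τ := by
    intro τ hτ
    by_cases h : Set.range τ ⊆ A
    · have := hv τ (Set.subset_inter h hτ)
      rw [hcA τ h, Pi.sub_apply, sub_eq_iff_eq_add, ← sub_eq_iff_eq_add', eq_comm]
      rw [Pi.sub_apply, Pi.sub_apply, sub_eq_zero] at this
      rw [← this]
    · exact if_neg h
  have hcong : ∀ (S : Set X) (c' : Cochain X R q),
      (∀ τ : Simplex X q, Set.range τ ⊆ S → c τ = c' τ) →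
      ∀ σ : Simplex X (q + 1), Set.range σ ⊆ S → coboundary X R q c σ = coboundary X R q c' σ := by
    intro S c' h σ hσ
    rw [coboundary_apply, coboundary_apply]
    refine Finset.sum_congr rfl fun i _ => congrArg _ (h _ ?_)
    rintro _ ⟨x, rfl⟩
    exact hσ ⟨_, rfl⟩
  -- The glued cochain `c` is a primitive only on simplices in A or in B; the small simplices
  -- theorem repairs the others by `e`.
  obtain ⟨e, he⟩ := exists_primitive_of_vanishesOn hA hB (f - coboundary X R q c) (by
      rw [map_sub, coboundary_coboundary, sub_zero]
      exact hf) (by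
      intro σ hσ
      rw [Pi.sub_apply, hcong A _ hcA σ hσ, map_sub, hg0, sub_zero]
      exact ha σ hσ) (by
      intro σ hσ
      rw [Pi.sub_apply, hcong B _ hcB σ hσ]
      exact hb σ hσ)
  rw [exactOn_succ_iff]
  exact ⟨c + e, by rwa [map_add, ← sub_sub]⟩

/-- If all non-empty intersections of a finite open family are acyclic, and no `d + 1` members
meet, then cocycles of degree at least `d` on the union are exact. -/
theorem exactOn_biUnion_of_forall_card_eq {ι : Type*} [DecidableEq ι] (s : Finset ι)
    (U : ι → Set X) (hU : ∀ i ∈ s, IsOpen (U i))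
    (hacyc : ∀ t ⊆ s, t.Nonempty → IsAcyclicSet R (⋂ i ∈ t, U i)) (d : ℕ) (hd : 1 ≤ d)
    (hempty : ∀ t ⊆ s, t.card = d + 1 → ⋂ i ∈ t, U i = ∅) (q : ℕ) (hq : d ≤ q + 1)
    (f : Cochain X R (q + 1)) (hf : VanishesOn (coboundary X R (q + 1) f) (⋃ i ∈ s, U i)) :
    ExactOn f (⋃ i ∈ s, U i) := by
  induction s using Finset.induction_on generalizing U d q with
  | empty =>
    simp only [Finset.notMem_empty, Set.iUnion_of_empty, Set.iUnion_empty]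
    exact exactOn_empty f
  | insert i s hi ih =>
    have hs : s ⊆ insert i s := Finset.subset_insert i s
    have hunion : ⋃ j ∈ insert i s, U j = (⋃ j ∈ s, U j) ∪ U i := by
      rw [Finset.set_biUnion_insert, Set.union_comm]
    rw [hunion] at hf ⊢
    have hBopen : IsOpen (U i) := hU i (Finset.mem_insert_self i s)
    refine ExactOn.union (A := ⋃ j ∈ s, U j) (isOpen_biUnion fun j hj => hU j (hs hj)) hBopen f hf ?_ ?_ ?_
    · exact ih U (fun j hj => hU j (hs hj)) (fun t ht => hacyc t (ht.trans hs)) d hd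
        (fun t ht => hempty t (ht.trans hs)) q hq f (hf.mono Set.subset_union_left)
    · have := hacyc {i} (by simp) (by simp) q f
      simp only [Finset.mem_singleton, Set.iInter_iInter_eq_left] at this
      exact this (hf.mono Set.subset_union_right)
    · have hint : (⋃ j ∈ s, U j) ∩ U i = ⋃ j ∈ s, (U j ∩ U i) := by
        simp only [Set.iUnion_inter]
      have hinter : ∀ t : Finset ι, t.Nonempty → ⋂ j ∈ t, (U j ∩ U i) =
          ⋂ j ∈ insert i t, U j := by
        intro t ht
        rw [Finset.set_biInter_insert, Set.inter_comm]
        exact (Set.biInter_inter (s := (t : Set ι)) ht U (U i))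
      rw [hint]
      -- The traces on `U i` lower both the degree and the bound `d` by one. If d = 1 the overlap is
      -- empty, so exactness of degree-0 cochains on a non-empty overlap is never needed.
      obtain rfl | hd2 := eq_or_lt_of_le hd
      · intro c _
        have : ⋃ j ∈ s, (U j ∩ U i) = ∅ := by
          simp only [Set.iUnion_eq_empty]
          intro j hj
          have hji : j ≠ i := fun h => hi (h ▸ hj)
          have := hempty {j, i} (by
            intro k hk
            rcases Finset.mem_insert.1 hk with rfl | hk
            · exact hs hj
            · exact Finset.mem_singleton.1 hk ▸ Finset.mem_insert_self i s) (Finset.card_pair hji)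
          rwa [Finset.set_biInter_insert, Finset.set_biInter_singleton] at this
        rw [this]
        exact exactOn_empty c
      · obtain ⟨q, rfl⟩ : ∃ k, q = k + 1 := ⟨q - 1, by omega⟩
        intro c hc
        refine ih (fun j => U j ∩ U i) (fun j hj => (hU j (hs hj)).inter hBopen)
          (fun t ht hne => ?_) (d - 1) (by omega) (fun t ht hcard => ?_) q (by omega) c hc
        · rw [hinter t hne]
          exact hacyc _ (Finset.insert_subset_insert i ht) (Finset.insert_nonempty _ _)
        · rw [hinter t (Finset.card_pos.1 (by omega))]
          refine hempty _ (Finset.insert_subset_insert i ht) ?_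
          rw [Finset.card_insert_of_notMem fun h => hi (ht h)]
          omega

/-- The pull-back of `f` is exact on the preimage and cohomologous to `f`. -/
theorem ExactOn.preimage {φ : C(X, X)} (h : φ.Homotopic (ContinuousMap.id X)) {n : ℕ} (hn : 1 ≤ n)
    {f : Cochain X R n} (hf : f ∈ cocycles X R n) {V : Set X} (hV : ExactOn f V) :
    ExactOn f (φ ⁻¹' V) := by
  obtain ⟨n, rfl⟩ : ∃ k, n = k + 1 := ⟨n - 1, by omega⟩
  refine ExactOn.of_sub_mem (g := pullCochain φ (n + 1) f) ?_ (pullCochain_sub_pullCochain_mem h f hf)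
  obtain ⟨g, hg, hv⟩ := hV
  refine ⟨_, pullCochain_mem_coboundaries φ (n + 1) g hg, fun σ hσ => hv _ ?_⟩
  rintro _ ⟨x, rfl⟩
  exact hσ ⟨x, rfl⟩

end Exact

/-! ### Graded commutativity and products of sequences -/

section Products

variable {X : Type u} [TopologicalSpace X] {R : Type v} [CommRing R]

theorem sub_onCochain_mem (θ : NaturalOperator R) {n : ℕ} (hn : 1 ≤ n) (f : Cochain X R n)
    (hf : f ∈ cocycles X R n) : f - θ.onCochain f ∈ coboundaries X R n := by
  obtain ⟨n, rfl⟩ : ∃ k, n = k + 1 := ⟨n - 1, by omega⟩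
  have hf0 : coboundary X R (n + 1) f = 0 := hf
  rw [sub_onCochain_eq, hf0]
  have h0 : prismOperator ContinuousMap.fst θ (0 : Cochain X R (n + 2)) = 0 := by
    ext σ
    exact prismOperator_eq_zero _ _ _ _ rfl
  rw [h0, zero_add]
  exact ⟨_, rfl⟩

theorem onCochain_mem_cocycles (θ : NaturalOperator R) {n : ℕ} (f : Cochain X R n)
    (hf : f ∈ cocycles X R n) : θ.onCochain f ∈ cocycles X R n := by
  change coboundary X R n _ = 0
  rw [← θ.onCochain_coboundary, show coboundary X R n f = 0 from hf]
  ext σ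
  exact congrFun (map_zero (θ.op (n + 1) (n + 2))) _

theorem reverseSign_mul_self (m : ℕ) : reverseSign R m * reverseSign R m = 1 := by
  induction m with
  | zero => exact one_mul 1
  | succ m ih =>
    have : (-1 : R) ^ m * (-1) ^ m = 1 := by rw [← mul_pow]; simp
    rw [reverseSign, mul_mul_mul_comm, ih, this, one_mul]

theorem reverseOp_onCochain {n : ℕ} (f : Cochain X R n) (σ : Simplex X n) :
    (reverseOp R).onCochain f σ = reverseSign R (n + 1) * f (σ.pull Fin.rev) := by
  have h : f (σ.pull Fin.rev) = simplexEval σ f (vertices n ∘ Fin.rev) := by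
    rw [← simplexEval_vertices (σ.pull Fin.rev) f, simplexEval_pull, ← map_comp_vertices]
    rfl
  rw [h]
  rfl

/-- Reversing the vertices exchanges front and back faces. -/
theorem onCochain_cupCochain {p q n : ℕ} (h : p + q = n) (h' : q + p = n) (f : Cochain X R p)
    (g : Cochain X R q) :
    (reverseOp R).onCochain (cupCochain h f g) =
      (reverseSign R (n + 1) * (reverseSign R (p + 1) * reverseSign R (q + 1))) •
        cupCochain h' ((reverseOp R).onCochain g) ((reverseOp R).onCochain f) := by
  ext σ
  have h1 : (σ.pull Fin.rev).pull (frontVertices (by omega : p ≤ n)) =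
      (σ.pull (backVertices (by omega : p ≤ n))).pull Fin.rev := by
    rw [Simplex.pull_pull, Simplex.pull_pull]
    congr 1
    funext j
    ext
    simp only [Function.comp_apply, frontVertices, backVertices, Fin.val_rev, Fin.val_castLE]
    omega
  have h2 : (σ.pull Fin.rev).pull (backVertices (by omega : q ≤ n)) =
      (σ.pull (frontVertices (by omega : q ≤ n))).pull Fin.rev := by
    rw [Simplex.pull_pull, Simplex.pull_pull]
    congr 1
    funext j
    ext
    simp only [Function.comp_apply, frontVertices, backVertices, Fin.val_rev, Fin.val_castLE]
    omega
  have hp := reverseSign_mul_self (R := R) (p + 1)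
  have hq := reverseSign_mul_self (R := R) (q + 1)
  rw [reverseOp_onCochain, Pi.smul_apply, cupCochain, cupCochain, reverseOp_onCochain,
    reverseOp_onCochain, h1, h2, smul_eq_mul]
  linear_combination (- reverseSign R (n + 1) * reverseSign R (q + 1) * reverseSign R (q + 1) *
    f ((σ.pull (backVertices (by omega : p ≤ n))).pull Fin.rev) *
    g ((σ.pull (frontVertices (by omega : q ≤ n))).pull Fin.rev)) * hp -
    reverseSign R (n + 1) *
    f ((σ.pull (backVertices (by omega : p ≤ n))).pull Fin.rev) *
    g ((σ.pull (frontVertices (by omega : q ≤ n))).pull Fin.rev) * hq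

/-- Graded commutativity of the cup product, with an unspecified sign. -/
theorem exists_cupCochain_sub_smul_mem {p q n : ℕ} (hp : 1 ≤ p) (hq : 1 ≤ q) (h : p + q = n)
    (h' : q + p = n) (f : cocycles X R p) (g : cocycles X R q) :
    ∃ c : R, c * c = 1 ∧
      cupCochain h f.1 g.1 - c • cupCochain h' g.1 f.1 ∈ coboundaries X R n := by
  set θ := reverseOp R
  set c := reverseSign R (n + 1) * (reverseSign R (p + 1) * reverseSign R (q + 1)) with hc
  refine ⟨c, ?_, ?_⟩
  · have h1 := reverseSign_mul_self (R := R) (p + 1)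
    have h2 := reverseSign_mul_self (R := R) (q + 1)
    have h3 := reverseSign_mul_self (R := R) (n + 1)
    rw [hc, mul_mul_mul_comm, h3, mul_mul_mul_comm, h1, h2, one_mul, one_mul]
  · set f' : cocycles X R p := ⟨θ.onCochain f.1, onCochain_mem_cocycles θ _ f.2⟩
    set g' : cocycles X R q := ⟨θ.onCochain g.1, onCochain_mem_cocycles θ _ g.2⟩
    have hcup : cupCochain h f.1 g.1 ∈ cocycles X R n := by
      subst h
      exact cup_mem_cocycles f g
    have h1 := sub_onCochain_mem θ (by omega) _ hcup
    have h2 := cup_mem_right h' g (f - f') (sub_onCochain_mem θ hp f.1 f.2)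
    have h3 := cup_mem_left h' (g - g') f' (sub_onCochain_mem θ hq g.1 g.2)
    rw [onCochain_cupCochain h h'] at h1
    -- Up to coboundaries, f ∪ g equals its reversal c • (g' ∪ f'), in which the reversals g' and f'
    -- may be replaced by g and f one at a time.
    have e : cupCochain h f.1 g.1 - c • cupCochain h' g.1 f.1 =
        (cupCochain h f.1 g.1 - c • cupCochain h' g'.1 f'.1) -
          c • (cupCochain h' g.1 (f - f').1 + cupCochain h' (g - g').1 f'.1) := by
      ext σ
      simp [cupCochain]
      ring
    rw [e]
    exact Submodule.sub_mem _ h1 (Submodule.smul_mem _ _ (Submodule.add_mem _ h2 h3))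

/-! ### Products of sequences and their permutations -/

/-- A cocycle representing a homogeneous class. -/
def HomogeneousClass.rep (u : HomogeneousClass X R) : cocycles X R u.deg :=
  (Submodule.Quotient.mk_surjective _ u.cls).choose

theorem HomogeneousClass.mk_rep (u : HomogeneousClass X R) :
    (Submodule.Quotient.mk u.rep : Cohomology X R u.deg) = u.cls :=
  (Submodule.Quotient.mk_surjective _ u.cls).choose_spec

/-- A cochain of degree `n` representing the product of a sequence of total degree `n`. -/
def productCochain : (s : List (HomogeneousClass X R)) → (n : ℕ) → Cochain X R n
  | [], _ => fun _ => 1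
  | u :: s, n => if h : u.deg + degSum s = n then cupCochain h u.rep.1 (productCochain s (degSum s))
      else 0

/-- The degree is a free argument of `productCochain`, so that permuted sequences give cochains of
the same type without casts. -/
theorem productCochain_cons {u : HomogeneousClass X R} {s : List (HomogeneousClass X R)} {m n : ℕ}
    (hm : degSum s = m) (h : u.deg + m = n) :
    productCochain (u :: s) n = cupCochain h u.rep.1 (productCochain s m) := by
  subst hm
  exact dif_pos h

theorem productCochain_mem_cocycles (s : List (HomogeneousClass X R)) {n : ℕ}
    (hn : degSum s = n) : productCochain s n ∈ cocycles X R n := by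
  subst hn
  induction s with
  | nil =>
    change coboundary X R 0 (fun _ => 1) = 0
    ext σ
    simp [coboundary_apply, Fin.sum_univ_succ]
  | cons u s ih =>
    rw [productCochain_cons (n := degSum (u :: s)) rfl rfl]
    exact cup_mem_cocycles u.rep ⟨_, ih⟩

theorem product_eq_mk (s : List (HomogeneousClass X R)) :
    product s = Submodule.Quotient.mk ⟨productCochain s (degSum s),
      productCochain_mem_cocycles s rfl⟩ := by
  induction s with
  | nil => rfl
  | cons u s ih =>
    change cup u.cls (product s) = _
    rw [ih, ← u.mk_rep, cup_mk]
    congr 1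
    exact Subtype.ext (productCochain_cons rfl rfl).symm

theorem product_eq_zero_iff (s : List (HomogeneousClass X R)) :
    product s = 0 ↔ productCochain s (degSum s) ∈ coboundaries X R (degSum s) := by
  rw [product_eq_mk]
  exact Submodule.Quotient.mk_eq_zero _

theorem degSum_eq_sum (s : List (HomogeneousClass X R)) :
    degSum s = (s.map HomogeneousClass.deg).sum := by
  induction s with
  | nil => rfl
  | cons a s ih => simp [degSum, ih]

theorem degSum_perm {s t : List (HomogeneousClass X R)} (h : s.Perm t) : degSum s = degSum t := by
  rw [degSum_eq_sum, degSum_eq_sum]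
  exact (h.map _).sum_eq

/-- Needed because a subsequence is taken up to permutation. A swap combines graded commutativity
with associativity, which holds strictly for cochains. -/
theorem exists_productCochain_sub_smul_mem {s t : List (HomogeneousClass X R)} (h : s.Perm t) :
    ∃ c : R, c * c = 1 ∧ ∀ n, degSum s = n →
      productCochain s n - c • productCochain t n ∈ coboundaries X R n := by
  induction h with
  | nil => exact ⟨1, one_mul 1, fun n _ => by simp⟩
  | @cons u s t h ih =>
    obtain ⟨c, hc, H⟩ := ih
    refine ⟨c, hc, fun n hn => ?_⟩
    rw [productCochain_cons rfl hn, productCochain_cons (degSum_perm h).symm hn]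
    set P : cocycles X R (degSum s) := ⟨_, productCochain_mem_cocycles s rfl⟩
    set Q : cocycles X R (degSum s) := ⟨_, productCochain_mem_cocycles t (degSum_perm h).symm⟩
    have e : cupCochain hn u.rep.1 P.1 - c • cupCochain hn u.rep.1 Q.1 =
        cupCochain hn u.rep.1 (P - c • Q).1 := by
      ext σ
      simp [cupCochain]
      ring
    refine (congrArg (· ∈ coboundaries X R n) e).mpr ?_
    exact cup_mem_right hn u.rep (P - c • Q) (H _ rfl)
  | swap u v s =>
    obtain ⟨c, hc, H⟩ := exists_cupCochain_sub_smul_mem v.one_le_deg u.one_le_deg rfl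
      (add_comm _ _) v.rep u.rep
    refine ⟨c, hc, fun n hn => ?_⟩
    have hn' : v.deg + (u.deg + degSum s) = n := hn
    have hn'' : u.deg + (v.deg + degSum s) = n := by omega
    rw [productCochain_cons (s := u :: s) (m := u.deg + degSum s) rfl hn',
      productCochain_cons (s := v :: s) (m := v.deg + degSum s) rfl hn'',
      productCochain_cons (u := u) rfl rfl, productCochain_cons (u := v) rfl rfl]
    set P : cocycles X R (degSum s) := ⟨_, productCochain_mem_cocycles s rfl⟩
    have hvu : cupCochain rfl v.rep.1 u.rep.1 ∈ cocycles X R (v.deg + u.deg) :=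
      cup_mem_cocycles v.rep u.rep
    have huv : cupCochain (add_comm u.deg v.deg) u.rep.1 v.rep.1 ∈
        cocycles X R (v.deg + u.deg) := by
      have := cup_mem_cocycles u.rep v.rep
      have hcast : ∀ (m : ℕ) (h : u.deg + v.deg = m),
          cupCochain h u.rep.1 v.rep.1 ∈ cocycles X R m := by
        rintro m rfl
        exact this
      exact hcast _ _
    have h3 : v.deg + u.deg + degSum s = n := by omega
    have key := cup_mem_left h3 (⟨_, hvu⟩ - c • ⟨_, huv⟩) P H
    convert key using 1
    ext σ
    have e1 : ∀ (p q r m : ℕ) (h1 : p + (q + r) = n) (h2 : p + q = m) (h3 : m + r = n)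
        (f : Cochain X R p) (g : Cochain X R q) (k : Cochain X R r),
        cupCochain h1 f (cupCochain rfl g k) σ = cupCochain h3 (cupCochain h2 f g) k σ := by
      rintro p q r m h1 rfl h3 f g k
      simp only [cupCochain, Simplex.pull_pull, ← mul_assoc]
      refine congrArg₂ (· * ·) (congrArg₂ (· * ·) (congrArg f (congrArg σ.pull ?_))
        (congrArg g (congrArg σ.pull ?_))) (congrArg k (congrArg σ.pull ?_)) <;>
      · funext j
        ext
        simp [frontVertices, backVertices]
        try omega
    rw [Pi.sub_apply, Pi.smul_apply, e1 _ _ _ _ _ rfl h3, e1 _ _ _ _ _ (add_comm _ _) h3]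
    simp [cupCochain]
    ring
  | @trans s t r h1 h2 ih1 ih2 =>
    obtain ⟨c, hc, H⟩ := ih1
    obtain ⟨c', hc', H'⟩ := ih2
    refine ⟨c * c', by rw [mul_mul_mul_comm, hc, hc', one_mul], fun n hn => ?_⟩
    have := Submodule.add_mem _ (H n hn)
      (Submodule.smul_mem _ c (H' n ((degSum_perm h1).symm.trans hn)))
    convert this using 1
    rw [smul_sub, smul_smul]
    abel

theorem product_eq_zero_of_perm {s t : List (HomogeneousClass X R)} (h : s.Perm t)
    (ht : productCochain t (degSum t) ∈ coboundaries X R (degSum t)) : product s = 0 := by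
  rw [product_eq_zero_iff]
  obtain ⟨c, -, H⟩ := exists_productCochain_sub_smul_mem h
  have h1 := H _ rfl
  rw [degSum_perm h] at h1 ⊢
  have := Submodule.add_mem _ h1 (Submodule.smul_mem _ c ht)
  rwa [sub_add_cancel] at this

/-- Weight estimators are controlled only at non-zero classes. -/
theorem cls_ne_zero_of_mem {s : List (HomogeneousClass X R)} (hs : product s ≠ 0)
    {u : HomogeneousClass X R} (hu : u ∈ s) : u.cls ≠ 0 := by
  induction s with
  | nil => simp at hu
  | cons v s ih =>
    change cup v.cls (product s) ≠ 0 at hs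
    rcases List.mem_cons.1 hu with rfl | hu
    · rintro h
      rw [h] at hs
      exact hs (by simp [cup])
    · refine ih (fun h => hs ?_) hu
      rw [h]
      simp [cup]

end Products

/-! ### Sets with the halo extension property -/

section Solid

variable {X : Type u} [TopologicalSpace X]

/-- `A` has the halo extension property for normal spaces: a map to `A` defined where `τ > 0`
coincides where `τ ≥ 1` with a map defined everywhere. -/
def IsSolid (A : Set X) : Prop :=
  ∀ (Z : Type u) [TopologicalSpace Z] [NormalSpace Z] (τ : C(Z, ℝ)) (g : Z → X),
    ContinuousOn g {z | 0 < τ z} → (∀ z, 0 < τ z → g z ∈ A) →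
    ∃ G : C(Z, X), (∀ z, G z ∈ A) ∧ ∀ z, 1 ≤ τ z → G z = g z

theorem isSolid_of_contractibleSpace (A : Set X) [ContractibleSpace A] : IsSolid A := by
  classical
  intro Z _ _ τ g hg hgA
  obtain ⟨a, ⟨H⟩⟩ := id_nullhomotopic A
  -- The contraction has not begun where τ ≥ 1 and is finished where τ ≤ 1/2, so the map extends by
  -- the constant `a`.
  set r : Z → unitInterval := fun z => Set.projIcc 0 1 zero_le_one (2 - 2 * τ z) with hr
  have hrc : Continuous r := continuous_projIcc.comp (by fun_prop)
  set G : Z → A := fun z => if h : 0 < τ z then H (r z, ⟨g z, hgA z h⟩) else a with hG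
  have hlow : ∀ z, τ z < 1 / 2 → G z = a := by
    intro z hz
    by_cases h : 0 < τ z
    · have : r z = 1 := Set.projIcc_of_right_le _ (by linarith)
      rw [hG]
      simp only [dif_pos h, this]
      exact H.map_one_left _
    · exact dif_neg h
  have hcont : Continuous G := by
    rw [continuous_iff_continuousAt]
    intro z
    by_cases hz : τ z < 1 / 2
    · have : G =ᶠ[nhds z] fun _ => a := by
        filter_upwards [(isOpen_lt τ.continuous continuous_const).mem_nhds hz] with y hy
        exact hlow y hy
      exact this.continuousAt
    · have hz0 : 0 < τ z := by linarith [not_lt.1 hz]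
      have hopen : IsOpen {z | 0 < τ z} := isOpen_lt continuous_const τ.continuous
      refine ContinuousOn.continuousAt (s := {z | 0 < τ z}) ?_ (hopen.mem_nhds hz0)
      rw [continuousOn_iff_continuous_domRestrict] at hg ⊢
      have : Set.domRestrict {z | 0 < τ z} G = fun z : {z | 0 < τ z} =>
          H (r z, ⟨g z, hgA z z.2⟩) := by
        funext z
        exact dif_pos z.2
      rw [this]
      exact H.continuous.comp ((hrc.comp continuous_subtype_val).prodMk (hg.subtype_mk _))
  refine ⟨⟨fun z => (G z : X), continuous_subtype_val.comp hcont⟩, fun z => (G z).2,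
    fun z hz => ?_⟩
  have h0 : 0 < τ z := by linarith
  have : r z = 0 := Set.projIcc_of_le_left _ (by linarith)
  change (G z : X) = g z
  simp only [hG, dif_pos h0, this]
  exact congrArg Subtype.val (H.map_zero_left _)

theorem IsSolid.exists_continuousOn {A : Set X} (hA : IsSolid A) {Z : Type u} [TopologicalSpace Z]
    [NormalSpace Z] {F : Set Z} (hF : IsClosed F) (τ : C(Z, ℝ)) (g : Z → X)
    (hg : ContinuousOn g (F ∩ {z | 0 < τ z})) (hgA : ∀ z ∈ F, 0 < τ z → g z ∈ A) :
    ∃ G : Z → X, ContinuousOn G F ∧ (∀ z ∈ F, G z ∈ A) ∧ ∀ z ∈ F, 1 ≤ τ z → G z = g z := by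
  classical
  have : NormalSpace F := hF.isClosedEmbedding_subtypeVal.normalSpace
  obtain ⟨G, hGA, hGg⟩ := hA F (τ.comp ⟨Subtype.val, continuous_subtype_val⟩) (fun z => g z)
    (hg.comp continuous_subtype_val.continuousOn fun z hz => ⟨z.2, hz⟩)
    (fun z hz => hgA z z.2 hz)
  refine ⟨fun z => if h : z ∈ F then G ⟨z, h⟩ else g z, ?_, fun z hz => ?_, fun z hz h => ?_⟩
  · rw [continuousOn_iff_continuous_domRestrict]
    have : Set.domRestrict F (fun z => if h : z ∈ F then G ⟨z, h⟩ else g z) = G := by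
      funext z
      exact dif_pos z.2
    rw [this]
    exact G.continuous
  · simp only [dif_pos hz]
    exact hGA _
  · simp only [dif_pos hz]
    exact hGg ⟨z, hz⟩ h

/-- One half of the gluing in `IsSolid.union`: the extension over l ≥ 1/2 must agree with `g` where
τ ≥ 1 and with `G₀` on the seam l = 1/2. -/
theorem IsSolid.exists_continuousOn_half {A : Set X} (hA : IsSolid A) {Z : Type u}
    [TopologicalSpace Z] [NormalSpace Z] (l τ : C(Z, ℝ)) (g G₀ : Z → X)
    (hg : ContinuousOn g {z | 0 < τ z}) (hgA : ∀ z, 1 / 4 ≤ τ z → 0 < l z → g z ∈ A)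
    (hG₀ : ContinuousOn G₀ {z | 1 / 4 ≤ l z ∧ l z ≤ 3 / 4})
    (hG₀A : ∀ z, 1 / 4 ≤ l z → l z ≤ 3 / 4 → G₀ z ∈ A)
    (hG₀g : ∀ z, 1 / 4 ≤ l z → l z ≤ 3 / 4 → 1 / 2 ≤ τ z → G₀ z = g z) :
    ∃ G : Z → X, ContinuousOn G {z | 1 / 2 ≤ l z} ∧ (∀ z, 1 / 2 ≤ l z → G z ∈ A) ∧
      (∀ z, 1 / 2 ≤ l z → 1 ≤ τ z → G z = g z) ∧ ∀ z, l z = 1 / 2 → G z = G₀ z := by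
  classical
  have hFc : IsClosed {z | 1 / 2 ≤ l z} := isClosed_le continuous_const l.continuous
  set k : Z → X := fun z => if l z < 3 / 4 then G₀ z else g z with hk
  have hk0 : ∀ z, l z < 3 / 4 → k z = G₀ z := fun z hz => if_pos hz
  have hkg : ∀ z, 1 / 2 ≤ l z → 1 / 2 ≤ τ z → k z = g z := by
    intro z h1 h2
    by_cases h : l z < 3 / 4
    · rw [hk0 z h]
      exact hG₀g z (by linarith) h.le h2
    · exact if_neg h
  obtain ⟨G, hGc, hGA, hGk⟩ := hA.exists_continuousOn hFc
    -- Positive exactly where τ > 1/2 or l < 3/4, where `k` is continuous with values in A; at least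
    -- 1 where τ ≥ 1 and on the seam.
    ⟨fun z => max (4 * τ z - 2) (6 - 8 * l z), by fun_prop⟩ k (by
      rintro z ⟨hz1, hz2⟩
      change 1 / 2 ≤ l z at hz1
      change 0 < max (4 * τ z - 2) (6 - 8 * l z) at hz2
      rcases lt_max_iff.1 hz2 with h | h
      · have hτ : 1 / 2 < τ z := by linarith
        have h1 : ContinuousAt g z := hg.continuousAt
          ((isOpen_lt continuous_const τ.continuous).mem_nhds (show 0 < τ z by linarith))
        refine h1.continuousWithinAt.congr_of_eventuallyEq ?_ (hkg z hz1 hτ.le)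
        filter_upwards [self_mem_nhdsWithin, mem_nhdsWithin_of_mem_nhds
          ((isOpen_lt continuous_const τ.continuous).mem_nhds hτ)] with y hy hy'
        exact hkg y hy.1 (le_of_lt hy')
      · have hl : l z < 3 / 4 := by linarith
        have h1 : ContinuousWithinAt G₀ {z | 1 / 4 ≤ l z ∧ l z ≤ 3 / 4} z :=
          hG₀ z ⟨by linarith, hl.le⟩
        have h2 : ContinuousAt G₀ z := h1.continuousAt (by
          filter_upwards [(isOpen_lt l.continuous continuous_const).mem_nhds hl,
            (isOpen_lt continuous_const l.continuous).mem_nhds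
              (show 1 / 4 < l z by linarith)] with y h1 h2
          exact ⟨le_of_lt h2, le_of_lt h1⟩)
        refine h2.continuousWithinAt.congr_of_eventuallyEq ?_ (hk0 z hl)
        filter_upwards [mem_nhdsWithin_of_mem_nhds
          ((isOpen_lt l.continuous continuous_const).mem_nhds hl)] with y hy
        exact hk0 y hy) (by
      intro z hz1 hz2
      change 1 / 2 ≤ l z at hz1
      change 0 < max (4 * τ z - 2) (6 - 8 * l z) at hz2
      by_cases h : l z < 3 / 4
      · rw [hk0 z h]
        exact hG₀A z (by linarith) h.le
      · have hτ : 1 / 2 < τ z := by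
          rcases lt_max_iff.1 hz2 with h' | h' <;> linarith [not_lt.1 h]
        rw [hkg z hz1 hτ.le]
        exact hgA z (by linarith) (by linarith))
  refine ⟨G, hGc, hGA, fun z hz hτ => ?_, fun z hz => ?_⟩
  · rw [hGk z hz (le_max_of_le_left (by linarith)), hkg z hz (by linarith)]
  · rw [hGk z hz.ge (le_max_of_le_right (by linarith)), hk0 z (by linarith)]

/-- A Urysohn function `l` separates the points sent outside A from those sent outside B. The map is
extended over the strip 1/4 ≤ l ≤ 3/4 into A ∩ B, then over each half into A or B, and glued along l
= 1/2. -/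
theorem IsSolid.union {A B : Set X} (hAo : IsOpen A) (hBo : IsOpen B) (hA : IsSolid A)
    (hB : IsSolid B) (hAB : IsSolid (A ∩ B)) : IsSolid (A ∪ B) := by
  classical
  intro Z _ _ τ g hg hgAB
  have hFc : IsClosed {z | 1 / 4 ≤ τ z} := isClosed_le continuous_const τ.continuous
  have hgF : ContinuousOn g {z | 1 / 4 ≤ τ z} := hg.mono fun z (hz : 1 / 4 ≤ τ z) =>
    show 0 < τ z by linarith
  have hcl : ∀ C : Set X, IsOpen C → IsClosed ({z | 1 / 4 ≤ τ z} ∩ g ⁻¹' Cᶜ) := fun C hC =>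
    hgF.preimage_isClosed_of_isClosed hFc hC.isClosed_compl
  obtain ⟨l, hl0, hl1, hl⟩ := exists_continuous_zero_one_of_isClosed (hcl A hAo) (hcl B hBo) (by
    rw [Set.disjoint_left]
    rintro z ⟨hz, hzA⟩ ⟨-, hzB⟩
    rcases hgAB z (show 0 < τ z by linarith [show 1 / 4 ≤ τ z from hz]) with h | h
    · exact hzA h
    · exact hzB h)
  have hlA : ∀ z, 1 / 4 ≤ τ z → 0 < l z → g z ∈ A := by
    intro z hz hlz
    by_contra h
    exact hlz.ne' (hl0 ⟨hz, h⟩)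
  have hlB : ∀ z, 1 / 4 ≤ τ z → l z < 1 → g z ∈ B := by
    intro z hz hlz
    by_contra h
    exact hlz.ne (hl1 ⟨hz, h⟩)
  have hZ₀ : IsClosed {z | 1 / 4 ≤ l z ∧ l z ≤ 3 / 4} :=
    (isClosed_le continuous_const l.continuous).inter (isClosed_le l.continuous continuous_const)
  obtain ⟨G₀, hG₀c, hG₀A, hG₀g⟩ := hAB.exists_continuousOn hZ₀ ⟨fun z => 4 * τ z - 1, by fun_prop⟩ g
    (hg.mono (by
      rintro z ⟨-, hz⟩
      change 0 < 4 * τ z - 1 at hz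
      change 0 < τ z
      linarith))
    (by
      rintro z ⟨h1, h2⟩ hz
      change 0 < 4 * τ z - 1 at hz
      exact ⟨hlA z (by linarith) (by linarith), hlB z (by linarith) (by linarith)⟩)
  obtain ⟨GA, hGAc, hGA, hGAg, hGA₀⟩ := hA.exists_continuousOn_half l τ g G₀ hg hlA hG₀c
    (fun z h1 h2 => (hG₀A z ⟨h1, h2⟩).1)
    (fun z h1 h2 h3 => hG₀g z ⟨h1, h2⟩ (show 1 ≤ 4 * τ z - 1 by linarith))
  obtain ⟨GB, hGBc, hGB, hGBg, hGB₀⟩ := hB.exists_continuousOn_half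
    ⟨fun z => 1 - l z, by fun_prop⟩ τ g G₀ hg
    (fun z h1 (h2 : 0 < 1 - l z) => hlB z h1 (by linarith))
    (hG₀c.mono (by
      rintro z ⟨h1, h2⟩
      change 1 / 4 ≤ 1 - l z at h1
      change 1 - l z ≤ 3 / 4 at h2
      exact ⟨by linarith, by linarith⟩))
    (fun z (h1 : 1 / 4 ≤ 1 - l z) (h2 : 1 - l z ≤ 3 / 4) =>
      (hG₀A z ⟨by linarith, by linarith⟩).2)
    (fun z (h1 : 1 / 4 ≤ 1 - l z) (h2 : 1 - l z ≤ 3 / 4) h3 =>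
      hG₀g z ⟨by linarith, by linarith⟩ (show 1 ≤ 4 * τ z - 1 by linarith))
  have hB' : {z | (1 : ℝ) / 2 ≤ 1 - l z} = {z | l z ≤ 1 / 2} := by
    ext z
    simp only [Set.mem_ofPred_eq]
    constructor <;> intro h <;> linarith
  change ContinuousOn GB {z | (1 : ℝ) / 2 ≤ 1 - l z} at hGBc
  rw [hB'] at hGBc
  set G : Z → X := fun z => if 1 / 2 ≤ l z then GA z else GB z with hG
  have hG1 : ∀ z, 1 / 2 ≤ l z → G z = GA z := fun z hz => if_pos hz
  have hG2 : ∀ z, l z ≤ 1 / 2 → G z = GB z := by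
    intro z hz
    rcases hz.lt_or_eq with h | h
    · exact if_neg (not_le.2 h)
    · rw [hG1 z h.ge, hGA₀ z h, hGB₀ z (show 1 - l z = 1 / 2 by linarith)]
  have hcont : Continuous G := by
    rw [← continuousOn_univ]
    have : (Set.univ : Set Z) = {z | 1 / 2 ≤ l z} ∪ {z | l z ≤ 1 / 2} := by
      ext z
      simpa using le_total _ _
    rw [this]
    exact ContinuousOn.union_of_isClosed (hGAc.congr hG1) (hGBc.congr hG2)
      (isClosed_le continuous_const l.continuous) (isClosed_le l.continuous continuous_const)
  refine ⟨⟨G, hcont⟩, fun z => ?_, fun z hz => ?_⟩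
  · change G z ∈ A ∪ B
    rcases le_total (1 / 2) (l z) with h | h
    · exact Or.inl ((hG1 z h).symm ▸ hGA z h)
    · exact Or.inr ((hG2 z h).symm ▸ hGB z (show 1 / 2 ≤ 1 - l z by linarith))
  · rcases le_total (1 / 2) (l z) with h | h
    · exact (hG1 z h).trans (hGAg z h hz)
    · exact (hG2 z h).trans (hGBg z (show 1 / 2 ≤ 1 - l z by linarith) hz)

theorem isSolid_biUnion {ι : Type*} [DecidableEq ι] (s : Finset ι) (hs : s.Nonempty) (U : ι → Set X)
    (hU : ∀ i ∈ s, IsOpen (U i)) (h : ∀ t ⊆ s, t.Nonempty → IsSolid (⋂ i ∈ t, U i)) :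
    IsSolid (⋃ i ∈ s, U i) := by
  induction hs using Finset.Nonempty.cons_induction generalizing U with
  | singleton i => simpa using h {i} subset_rfl (Finset.singleton_nonempty i)
  | cons i s hi hs ih =>
    rw [Finset.cons_eq_insert] at hU h ⊢
    have hsub : s ⊆ insert i s := Finset.subset_insert i s
    have hint : U i ∩ ⋃ j ∈ s, U j = ⋃ j ∈ s, (U j ∩ U i) := by
      rw [Set.inter_comm]
      simp only [Set.iUnion_inter]
    rw [Finset.set_biUnion_insert]
    refine IsSolid.union (hU i (Finset.mem_insert_self i s))
      (isOpen_biUnion fun j hj => hU j (hsub hj)) ?_ ?_ ?_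
    · simpa using h {i} (by simp) (Finset.singleton_nonempty i)
    · exact ih U (fun j hj => hU j (hsub hj)) fun t ht => h t (ht.trans hsub)
    · rw [hint]
      refine ih (fun j => U j ∩ U i)
        (fun j hj => (hU j (hsub hj)).inter (hU i (Finset.mem_insert_self i s))) fun t ht hne => ?_
      have : ⋂ j ∈ t, (U j ∩ U i) = ⋂ j ∈ insert i t, U j := by
        rw [Finset.set_biInter_insert, Set.inter_comm]
        exact (Set.biInter_inter (s := (t : Set ι)) hne U (U i))
      rw [this]
      exact h _ (Finset.insert_subset_insert i ht) (Finset.insert_nonempty _ _)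

/-- On D × I prescribe `f` near the bottom and a constant near the top. The halo function 2|2t - 1|
- 1 is 1 at both ends and negative around t = 1/2, so the extension is a null-homotopy. -/
theorem IsSolid.nullhomotopic {A : Set X} (hA : IsSolid A) (hne : A.Nonempty) {K : Type u}
    [TopologicalSpace K] [NormalSpace (K × unitInterval)] (f : C(K, X)) {D : Set K}
    (hD : IsClosed D) (hf : ∀ z ∈ D, f z ∈ A) : (f.comp (inclusion D)).Nullhomotopic := by
  classical
  obtain ⟨x, hx⟩ := hne
  obtain ⟨G, hGc, -, hGg⟩ := hA.exists_continuousOn (Z := K × unitInterval)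
    (hD.preimage continuous_fst) ⟨fun z => 2 * |2 * (z.2 : ℝ) - 1| - 1, by fun_prop⟩
    (fun z => if (z.2 : ℝ) < 1 / 2 then f z.1 else x) (by
      refine ContinuousOn.mono (s := {z : K × unitInterval | (z.2 : ℝ) ≠ 1 / 2}) ?_ ?_
      · intro z hz
        refine ContinuousAt.continuousWithinAt ?_
        have hc : Continuous fun z : K × unitInterval => (z.2 : ℝ) := by fun_prop
        rcases lt_or_gt_of_ne hz with h | h
        · have : (fun z : K × unitInterval => if (z.2 : ℝ) < 1 / 2 then f z.1 else x) =ᶠ[nhds z]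
              fun z => f z.1 := by
            filter_upwards [(isOpen_lt hc continuous_const).mem_nhds h] with y hy
            exact if_pos hy
          exact (f.continuous.comp continuous_fst).continuousAt.congr this.symm
        · have : (fun z : K × unitInterval => if (z.2 : ℝ) < 1 / 2 then f z.1 else x) =ᶠ[nhds z]
              fun _ => x := by
            filter_upwards [(isOpen_lt continuous_const hc).mem_nhds h] with y hy
            exact if_neg (not_lt.2 (le_of_lt hy))
          exact continuousAt_const.congr this.symm
      · rintro z ⟨-, hz⟩ (h : (z.2 : ℝ) = 1 / 2)
        change 0 < 2 * |2 * (z.2 : ℝ) - 1| - 1 at hz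
        rw [h] at hz
        norm_num at hz) (by
      intro z hz _
      by_cases h : (z.2 : ℝ) < 1 / 2
      · simp only [if_pos h]
        exact hf _ hz
      · simpa only [if_neg h] using hx)
  refine ⟨x, ⟨⟨⟨fun p => G (p.2.1, p.1), ?_⟩, fun z => ?_, fun z => ?_⟩⟩⟩
  · refine hGc.comp_continuous ?_ fun p => p.2.2
    fun_prop
  · refine (hGg (z.1, 0) z.2 ?_).trans ?_
    · change (1 : ℝ) ≤ 2 * |2 * (0 : ℝ) - 1| - 1
      norm_num
    · exact if_pos (by change (0 : ℝ) < 1 / 2; norm_num)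
  · refine (hGg (z.1, 1) z.2 ?_).trans ?_
    · change (1 : ℝ) ≤ 2 * |2 * (1 : ℝ) - 1| - 1
      norm_num
    · exact if_neg (by change ¬ (1 : ℝ) < 1 / 2; norm_num)

end Solid

/-! ### Normality of the product of a CW complex and a compact Hausdorff space -/

section CW

open Topology Metric Set

/-- A continuous map from a compact to a Hausdorff space is closed, hence a quotient map onto its
image. -/
theorem continuousOn_image_of_comp {D Y Z : Type*} [TopologicalSpace D] [TopologicalSpace Y]
    [TopologicalSpace Z] [T2Space Y] [CompactSpace D] {q : D → Y} (hq : Continuous q) {h : Y → Z}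
    (hh : Continuous (h ∘ q)) : ContinuousOn h (range q) := by
  rw [continuousOn_iff_isClosed]
  intro C hC
  refine ⟨q '' ((h ∘ q) ⁻¹' C), ((hC.preimage hh).isCompact.image hq).isClosed, ?_⟩
  ext y
  constructor
  · rintro ⟨hy, x, rfl⟩
    exact ⟨⟨x, hy, rfl⟩, x, rfl⟩
  · rintro ⟨⟨x, hx, rfl⟩, -⟩
    exact ⟨hx, x, rfl⟩

/-- Tietze extension relative to two disjoint closed sets on which the values `0` and `1` are
prescribed. -/
theorem exists_extension_zero_one {D : Type*} [TopologicalSpace D] [NormalSpace D] {S A B : Set D}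
    (hS : IsClosed S) (hA : IsClosed A) (hB : IsClosed B) (hAB : Disjoint A B) (h : D → ℝ)
    (hc : ContinuousOn h S) (h0 : ∀ x ∈ S, x ∈ A → h x = 0) (h1 : ∀ x ∈ S, x ∈ B → h x = 1) :
    ∃ g : C(D, ℝ), (∀ x ∈ S, g x = h x) ∧ (∀ x ∈ A, g x = 0) ∧ ∀ x ∈ B, g x = 1 := by
  classical
  set k : D → ℝ := fun x => if x ∈ A then 0 else if x ∈ B then 1 else h x with hk
  have hkA : ∀ x ∈ A, k x = 0 := fun x hx => if_pos hx
  have hkB : ∀ x ∈ B, k x = 1 := by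
    intro x hx
    have : x ∉ A := fun h => Set.disjoint_left.1 hAB h hx
    simp [hk, this, hx]
  have hkS : ∀ x ∈ S, k x = h x := by
    intro x hx
    by_cases hxA : x ∈ A
    · rw [hkA x hxA, h0 x hx hxA]
    · by_cases hxB : x ∈ B
      · rw [hkB x hxB, h1 x hx hxB]
      · simp [hk, hxA, hxB]
  have hkc : ContinuousOn k (S ∪ (A ∪ B)) :=
    (hc.congr hkS).union_of_isClosed
      ((continuousOn_const.congr hkA).union_of_isClosed (continuousOn_const.congr hkB) hA hB)
      hS (hA.union hB)
  obtain ⟨g, hg⟩ := ContinuousMap.exists_restrict_eq (hS.union (hA.union hB))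
    ⟨_, continuousOn_iff_continuous_domRestrict.1 hkc⟩
  have hgk : ∀ x ∈ S ∪ (A ∪ B), g x = k x := fun x hx => DFunLike.congr_fun hg ⟨x, hx⟩
  exact ⟨g, fun x hx => (hgk x (Or.inl hx)).trans (hkS x hx),
    fun x hx => (hgk x (Or.inr (Or.inl hx))).trans (hkA x hx),
    fun x hx => (hgk x (Or.inr (Or.inr hx))).trans (hkB x hx)⟩

variable {K : Type*} [TopologicalSpace K] [CWComplex (univ : Set K)]
  {T : Type*} [TopologicalSpace T]

theorem exists_closedCell_of_mem_frontier {n : ℕ} (e : RelCWComplex.cell (univ : Set K) n)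
    {d : Fin n → ℝ} (hd : d ∈ sphere (0 : Fin n → ℝ) 1) :
    ∃ m < n, ∃ j : RelCWComplex.cell (univ : Set K) m,
      RelCWComplex.map n e d ∈ RelCWComplex.openCell m j := by
  obtain ⟨I, hI⟩ := CWComplex.cellFrontier_subset_finite_openCell n e
  have := hI (mem_image_of_mem _ hd)
  simp only [mem_iUnion] at this
  obtain ⟨m, hm, j, -, hj⟩ := this
  exact ⟨m, hm, j, hj⟩

theorem notMem_openCell_of_lt {m n : ℕ} (hmn : m < n) (j : RelCWComplex.cell (univ : Set K) m)
    (e : RelCWComplex.cell (univ : Set K) n) {x : K} (hx : x ∈ RelCWComplex.openCell m j) :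
    x ∉ RelCWComplex.openCell n e := by
  intro hx'
  have hne : (⟨m, j⟩ : Σ n, RelCWComplex.cell (univ : Set K) n) ≠ ⟨n, e⟩ := by
    intro h
    exact hmn.ne (congrArg Sigma.fst h)
  exact Set.disjoint_left.1 (RelCWComplex.disjoint_openCell_of_ne hne) hx hx'

theorem notMem_openCell_of_mem_closedCell {m n : ℕ} (hmn : m < n)
    (j : RelCWComplex.cell (univ : Set K) m)
    (e : RelCWComplex.cell (univ : Set K) n) {x : K} (hx : x ∈ RelCWComplex.closedCell m j) :
    x ∉ RelCWComplex.openCell n e := by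
  rw [← RelCWComplex.cellFrontier_union_openCell_eq_closedCell] at hx
  rcases hx with ⟨d, hd, rfl⟩ | hx
  · obtain ⟨l, hl, i, hi⟩ := exists_closedCell_of_mem_frontier j hd
    exact notMem_openCell_of_lt (hl.trans hmn) i e hi
  · exact notMem_openCell_of_lt hmn j e hx

/-- On the cells of dimension less than `n`, the function `h` is continuous, vanishes on `A` and is
`1` on `B`. -/
def SeparatesOnCells (A B : Set (K × T)) (n : ℕ) (h : K × T → ℝ) : Prop :=
  ∀ m < n, ∀ j : RelCWComplex.cell (univ : Set K) m,
    ContinuousOn h (RelCWComplex.closedCell m j ×ˢ univ) ∧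
    ∀ p ∈ RelCWComplex.closedCell m j ×ˢ (univ : Set T), (p ∈ A → h p = 0) ∧ (p ∈ B → h p = 1)

variable [T2Space K] [CompactSpace T] [T2Space T]

/-- Each n-cell times T is handled by Tietze extension on the compact Hausdorff space D × T: the
values are given over the boundary sphere and on the preimages of A and B. -/
theorem SeparatesOnCells.exists_succ {A B : Set (K × T)} (hA : IsClosed A) (hB : IsClosed B)
    (hAB : Disjoint A B) {n : ℕ} {h : K × T → ℝ} (H : SeparatesOnCells A B n h) :
    ∃ h' : K × T → ℝ, SeparatesOnCells A B (n + 1) h' ∧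
      ∀ m < n, ∀ j : RelCWComplex.cell (univ : Set K) m,
        EqOn h' h (RelCWComplex.closedCell m j ×ˢ univ) := by
  classical
  let D := closedBall (0 : Fin n → ℝ) 1
  have : CompactSpace D := isCompact_iff_compactSpace.1 (isCompact_closedBall _ _)
  let q : RelCWComplex.cell (univ : Set K) n → D × T → K × T :=
    fun e p => (RelCWComplex.map n e p.1.1, p.2)
  have hq : ∀ e, Continuous (q e) := fun e =>
    ((continuousOn_iff_continuous_domRestrict.1 (RelCWComplex.continuousOn n e)).comp
      continuous_fst).prodMk continuous_snd
  let S : Set (D × T) := {p | p.1.1 ∈ sphere (0 : Fin n → ℝ) 1}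
  have hS : IsClosed S := isClosed_sphere.preimage (continuous_subtype_val.comp continuous_fst)
  have hfr : ∀ e, ∀ p ∈ S, ∃ m < n, ∃ j : RelCWComplex.cell (univ : Set K) m,
      q e p ∈ RelCWComplex.openCell m j ×ˢ (univ : Set T) := by
    intro e p hp
    obtain ⟨m, hm, j, hj⟩ := exists_closedCell_of_mem_frontier e hp
    exact ⟨m, hm, j, hj, trivial⟩
  have hsub : ∀ m (j : RelCWComplex.cell (univ : Set K) m),
      RelCWComplex.openCell m j ×ˢ (univ : Set T) ⊆ RelCWComplex.closedCell m j ×ˢ univ := fun m j =>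
    prod_mono_left (RelCWComplex.openCell_subset_closedCell m j)
  have hcS : ∀ e, ContinuousOn (h ∘ q e) S := by
    -- The frontier meets finitely many lower cells, so continuity on each of them suffices.
    intro e
    obtain ⟨I, hI⟩ := CWComplex.cellFrontier_subset_finite_closedCell n e
    have hcl : ∀ m (j : RelCWComplex.cell (univ : Set K) m),
        IsClosed (RelCWComplex.closedCell m j ×ˢ (univ : Set T)) := fun m j =>
      RelCWComplex.isClosed_closedCell.prod isClosed_univ
    have hcont : ContinuousOn h (⋃ p : (Σ m : Fin n, {j // j ∈ I m}),
        RelCWComplex.closedCell p.1.1 p.2.1 ×ˢ (univ : Set T)) :=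
      (locallyFinite_of_finite _).continuousOn_iUnion (fun p => hcl _ _)
        fun p => (H p.1.1 p.1.2 p.2.1).1
    refine hcont.comp (hq e).continuousOn fun p hp => ?_
    have := hI (mem_image_of_mem _ hp)
    simp only [mem_iUnion] at this
    obtain ⟨m, hm, j, hj, hx⟩ := this
    exact mem_iUnion.2 ⟨⟨⟨m, hm⟩, ⟨j, hj⟩⟩, hx, trivial⟩
  have hex : ∀ e, ∃ g : C(D × T, ℝ), (∀ p ∈ S, g p = h (q e p)) ∧
      (∀ p, q e p ∈ A → g p = 0) ∧ ∀ p, q e p ∈ B → g p = 1 := by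
    intro e
    refine exists_extension_zero_one hS (hA.preimage (hq e)) (hB.preimage (hq e))
      (hAB.preimage _) (h ∘ q e) (hcS e) ?_ ?_
    · intro p hp hpA
      obtain ⟨m, hm, j, hj⟩ := hfr e p hp
      exact ((H m hm j).2 _ (hsub m j hj)).1 hpA
    · intro p hp hpB
      obtain ⟨m, hm, j, hj⟩ := hfr e p hp
      exact ((H m hm j).2 _ (hsub m j hj)).2 hpB
  choose g hgS hgA hgB using hex
  have hcellmem : ∀ (e : RelCWComplex.cell (univ : Set K) n) (p : K × T),
      p.1 ∈ RelCWComplex.openCell n e → ∃ p' : D × T, q e p' = p := by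
    rintro e ⟨x, t⟩ ⟨d, hd, hx⟩
    exact ⟨(⟨d, ball_subset_closedBall hd⟩, t), Prod.ext hx rfl⟩
  -- The preimage is chosen arbitrarily; injectivity of the characteristic map on the open ball
  -- makes the choice harmless (`hqe`).
  set h' : K × T → ℝ := fun p =>
    if hp : ∃ e : RelCWComplex.cell (univ : Set K) n, p.1 ∈ RelCWComplex.openCell n e then
      g hp.choose (hcellmem _ p hp.choose_spec).choose else h p with hh'
  have hlow : ∀ p : K × T, (∀ e : RelCWComplex.cell (univ : Set K) n,
      p.1 ∉ RelCWComplex.openCell n e) → h' p = h p := by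
    intro p hp
    have : ¬ ∃ e : RelCWComplex.cell (univ : Set K) n, p.1 ∈ RelCWComplex.openCell n e :=
      fun ⟨e, he⟩ => hp e he
    exact dif_neg this
  have hqe : ∀ e p, h' (q e p) = g e p := by
    intro e p
    by_cases hp : p ∈ S
    · rw [hgS e p hp]
      refine hlow _ fun e' => ?_
      obtain ⟨m, hm, j, hj⟩ := hfr e p hp
      exact notMem_openCell_of_lt hm j e' hj.1
    · have hball : p.1.1 ∈ ball (0 : Fin n → ℝ) 1 := by
        have h1 : dist p.1.1 0 ≤ 1 := p.1.2
        exact lt_of_le_of_ne h1 hp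
      have hmem : ∃ e' : RelCWComplex.cell (univ : Set K) n,
        (q e p).1 ∈ RelCWComplex.openCell n e' := ⟨e, mem_image_of_mem _ hball⟩
      have he : hmem.choose = e := by
        by_contra hne
        have hne' : (⟨n, hmem.choose⟩ : Σ n, RelCWComplex.cell (univ : Set K) n) ≠ ⟨n, e⟩ := by
          intro h
          exact hne (eq_of_heq (Sigma.mk.inj h).2)
        exact Set.disjoint_left.1 (RelCWComplex.disjoint_openCell_of_ne hne') hmem.choose_spec
          (mem_image_of_mem _ hball)
      have h1 : h' (q e p) = g hmem.choose
          (hcellmem _ (q e p) hmem.choose_spec).choose := dif_pos hmem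
      rw [h1]
      have h2 := (hcellmem _ (q e p) hmem.choose_spec).choose_spec
      set p' := (hcellmem _ (q e p) hmem.choose_spec).choose
      rw [he] at h2 ⊢
      congr 1
      have hmap : RelCWComplex.map n e p'.1.1 = RelCWComplex.map n e p.1.1 := congrArg Prod.fst h2
      have hsnd : p'.2 = p.2 := (Prod.ext_iff.1 h2).2
      refine Prod.ext (Subtype.ext ?_) hsnd
      have hball' : p'.1.1 ∈ ball (0 : Fin n → ℝ) 1 := by
        by_contra hb
        have hs : p' ∈ S := by
          have h1 : dist p'.1.1 0 ≤ 1 := p'.1.2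
          exact le_antisymm h1 (not_lt.1 hb)
        obtain ⟨m, hm, j, hj⟩ := hfr e p' hs
        refine notMem_openCell_of_lt hm j e hj.1 ?_
        change RelCWComplex.map n e p'.1.1 ∈ _
        rw [hmap]
        exact mem_image_of_mem _ hball
      refine (RelCWComplex.map n e).injOn ?_ ?_ hmap
      · rwa [RelCWComplex.source_eq]
      · rwa [RelCWComplex.source_eq]
  have hrange : ∀ e : RelCWComplex.cell (univ : Set K) n,
      range (q e) = RelCWComplex.closedCell n e ×ˢ univ := by
    intro e
    ext ⟨x, t⟩
    constructor
    · rintro ⟨p, hp⟩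
      exact ⟨⟨p.1.1, p.1.2, congrArg Prod.fst hp⟩, trivial⟩
    · rintro ⟨⟨d, hd, hx⟩, -⟩
      exact ⟨(⟨d, hd⟩, t), Prod.ext hx rfl⟩
  have heq : ∀ m < n, ∀ j : RelCWComplex.cell (univ : Set K) m,
      EqOn h' h (RelCWComplex.closedCell m j ×ˢ univ) := fun m hm j p hp =>
    hlow p fun e => notMem_openCell_of_mem_closedCell hm j e hp.1
  refine ⟨h', fun m hm j => ?_, heq⟩
  rcases Nat.lt_succ_iff_lt_or_eq.1 hm with hm | rfl
  · refine ⟨(H m hm j).1.congr (heq m hm j), fun p hp => ?_⟩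
    rw [heq m hm j hp]
    exact (H m hm j).2 p hp
  · rw [← hrange j]
    refine ⟨continuousOn_image_of_comp (hq j) ?_, ?_⟩
    · rw [show h' ∘ q j = g j from funext (hqe j)]
      exact (g j).continuous
    · rintro _ ⟨p, rfl⟩
      rw [hqe]
      exact ⟨hgA j p, hgB j p⟩

/-- The topology of K, not that of K × T, is known to be determined by cells. Currying gives a map
from K to C(T, ℝ), whose continuity is tested on cells; compactness of T allows uncurrying. -/
theorem continuous_of_continuousOn_closedCell {h : K × T → ℝ}
    (H : ∀ n (j : RelCWComplex.cell (univ : Set K) n),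
      ContinuousOn h (RelCWComplex.closedCell n j ×ˢ univ)) : Continuous h := by
  have hcover : ∀ x : K, ∃ n, ∃ j : RelCWComplex.cell (univ : Set K) n,
      x ∈ RelCWComplex.closedCell n j := by
    intro x
    have : x ∈ ⋃ (n : ℕ) (j : RelCWComplex.cell (univ : Set K) n), RelCWComplex.closedCell n j := by
      rw [CWComplex.union]
      trivial
    simpa using this
  have hx : ∀ x, Continuous fun t => h (x, t) := by
    intro x
    obtain ⟨n, j, hj⟩ := hcover x
    exact (H n j).comp_continuous (by fun_prop) fun t => ⟨hj, trivial⟩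
  let c : K → C(T, ℝ) := fun x => ⟨fun t => h (x, t), hx x⟩
  have hc : Continuous c := by
    rw [continuous_iff_isClosed]
    intro C hC
    rw [CWComplex.closed univ _ (subset_univ _)]
    intro n j
    have hcell : ContinuousOn c (RelCWComplex.closedCell n j) := by
      rw [continuousOn_iff_continuous_domRestrict]
      refine ContinuousMap.continuous_of_continuous_uncurry _ ?_
      exact (H n j).comp_continuous
        (f := fun p : RelCWComplex.closedCell n j × T => ((p.1 : K), p.2)) (by fun_prop)
        fun p => ⟨p.1.2, trivial⟩
    rw [inter_comm]
    exact hcell.preimage_isClosed_of_isClosed RelCWComplex.isClosed_closedCell hC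
  have : h = fun p : K × T => c p.1 p.2 := rfl
  rw [this]
  exact ContinuousMap.continuous_uncurry_of_continuous ⟨c, hc⟩

-- A Urysohn function is built by dimension of cells; on a cell of dimension m it no longer changes
-- after stage m + 1.
variable (K T) in
theorem normalSpace_prod_of_cwComplex : NormalSpace (K × T) := by
  classical
  refine ⟨fun A B hA hB hAB => ?_⟩
  choose! F hF using fun (n : ℕ) (h : {h : K × T → ℝ // SeparatesOnCells A B n h}) =>
    h.2.exists_succ hA hB hAB
  let G : (n : ℕ) → {h : K × T → ℝ // SeparatesOnCells A B n h} := fun n =>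
    Nat.rec ⟨0, fun m hm => absurd hm (Nat.not_lt_zero m)⟩ (fun n h => ⟨F n h, (hF n h).1⟩) n
  have hstep : ∀ n m, m < n → ∀ j : RelCWComplex.cell (univ : Set K) m,
      EqOn (G (n + 1)).1 (G n).1 (RelCWComplex.closedCell m j ×ˢ univ) := fun n m hm j =>
    (hF n (G n)).2 m hm j
  have hstable : ∀ n m, m < n → ∀ j : RelCWComplex.cell (univ : Set K) m,
      EqOn (G n).1 (G (m + 1)).1 (RelCWComplex.closedCell m j ×ˢ univ) := by
    intro n m hmn j
    induction n, Nat.succ_le_of_lt hmn using Nat.le_induction with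
    | base => exact fun _ _ => rfl
    | succ n hn ih => exact (hstep n m hn j).trans (ih hn)
  have hcover : ∀ x : K, ∃ n, ∃ j : RelCWComplex.cell (univ : Set K) n,
      x ∈ RelCWComplex.closedCell n j := by
    intro x
    have : x ∈ ⋃ (n : ℕ) (j : RelCWComplex.cell (univ : Set K) n), RelCWComplex.closedCell n j := by
      rw [CWComplex.union]
      trivial
    simpa using this
  choose N J hJ using hcover
  let h : K × T → ℝ := fun p => (G (N p.1 + 1)).1 p
  have hcell : ∀ m (j : RelCWComplex.cell (univ : Set K) m),
      EqOn h (G (m + 1)).1 (RelCWComplex.closedCell m j ×ˢ univ) := by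
    intro m j p hp
    have hp' : p ∈ RelCWComplex.closedCell (N p.1) (J p.1) ×ˢ (univ : Set T) := ⟨hJ p.1, trivial⟩
    have h1 := hstable (max m (N p.1) + 1) m (by omega) j hp
    have h2 := hstable (max m (N p.1) + 1) (N p.1) (by omega) (J p.1) hp'
    exact h2.symm.trans h1
  have hcont : Continuous h := continuous_of_continuousOn_closedCell fun m j =>
    ((G (m + 1)).2 m (Nat.lt_succ_self m) j).1.congr (hcell m j)
  have hval : ∀ p, (p ∈ A → h p = 0) ∧ (p ∈ B → h p = 1) := fun p =>
    ((G (N p.1 + 1)).2 _ (Nat.lt_succ_self _) (J p.1)).2 p ⟨hJ p.1, trivial⟩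
  refine ⟨{p | h p < 1 / 2}, {p | 1 / 2 < h p}, isOpen_lt hcont continuous_const,
    isOpen_lt continuous_const hcont, fun p hp => ?_, fun p hp => ?_, ?_⟩
  · change h p < 1 / 2
    rw [(hval p).1 hp]
    norm_num
  · change 1 / 2 < h p
    rw [(hval p).2 hp]
    norm_num
  · rw [Set.disjoint_left]
    exact fun p (h1 : h p < 1 / 2) (h2 : 1 / 2 < h p) => lt_asymm h1 h2

end CW

/-! ### Category weight and good covers -/

section Main

open Topology

theorem normalSpace_of_prod {K T : Type*} [TopologicalSpace K] [TopologicalSpace T] [T1Space T]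
    [Nonempty T] [NormalSpace (K × T)] : NormalSpace K := by
  have t : T := Classical.arbitrary T
  have he : IsClosedEmbedding fun x : K => (x, t) := by
    refine IsClosedEmbedding.of_continuous_injective_isClosedMap (by fun_prop)
      (fun x y h => (Prod.ext_iff.1 h).1) fun F hF => ?_
    have : (fun x : K => (x, t)) '' F = F ×ˢ {t} := by
      ext ⟨x, t'⟩
      constructor
      · rintro ⟨y, hy, h⟩
        obtain ⟨rfl, rfl⟩ := Prod.ext_iff.1 h
        exact ⟨hy, rfl⟩
      · rintro ⟨hx, ht⟩
        exact ⟨x, hx, Prod.ext rfl (Set.mem_singleton_iff.1 ht).symm⟩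
    rw [this]
    exact hF.prod isClosed_singleton
  exact he.normalSpace

variable {X : Type u} [TopologicalSpace X] {R : Type v} [CommRing R]

/-- Open sets `A i` that are solid or empty, which together with `V` cover a space of the homotopy
type of a CW complex, can be replaced by closed sets `E i` of category at most one whose interiors
cover, together with the preimage of `V` under a self-map homotopic to the identity. -/
theorem HasCWHomotopyType.exists_categorical_shrinking [Nonempty X] (hX : HasCWHomotopyType X)
    {ι : Type*} [Finite ι] (A : ι → Set X) (hA : ∀ i, IsOpen (A i))
    (hsolid : ∀ i, A i = ∅ ∨ IsSolid (A i)) (V : Set X) (hV : IsOpen V)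
    (hcover : (⋃ i, A i) ∪ V = Set.univ) :
    ∃ (φ : C(X, X)) (E O P : ι → Set X), φ.Homotopic (ContinuousMap.id X) ∧
      (∀ i, IsClosed (E i)) ∧ (∀ i, IsOpen (O i)) ∧ (∀ i, IsCategorical (O i)) ∧
      (∀ i, E i ⊆ O i) ∧ (∀ i, IsOpen (P i)) ∧ (∀ i, P i ⊆ E i) ∧
      (⋃ i, P i) ∪ φ ⁻¹' V = Set.univ := by
  obtain ⟨K, _, _, ⟨_⟩, ⟨e⟩⟩ := hX
  have hnorm : NormalSpace (K × unitInterval) := normalSpace_prod_of_cwComplex K unitInterval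
  have hnormK : NormalSpace K := normalSpace_of_prod (T := unitInterval)
  set f : C(K, X) := e.invFun
  set g : C(X, K) := e.toFun
  have hφ : (f.comp g).Homotopic (ContinuousMap.id X) := e.left_inv
  -- The index `none` stands for V.
  let W : Option ι → Set K := fun o => f ⁻¹' (o.elim V A)
  obtain ⟨v, hvu, hvo, hvc⟩ := exists_iUnion_eq_closure_subset (u := W)
    (fun o => IsOpen.preimage f.continuous (by cases o <;> simp [hV, hA]))
    (fun _ => Set.toFinite _) (by
      ext x
      simp only [W, Set.mem_iUnion, Set.mem_preimage, Set.mem_univ, iff_true]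
      have : f x ∈ (⋃ i, A i) ∪ V := hcover ▸ Set.mem_univ _
      rcases this with h | h
      · obtain ⟨i, hi⟩ := Set.mem_iUnion.1 h
        exact ⟨some i, hi⟩
      · exact ⟨none, h⟩)
  -- A second shrinking: category requires open sets around the closed ones, while solidity gives
  -- null-homotopies only on closed sets.
  have hex : ∀ i, ∃ o : Set K, IsOpen o ∧ closure (v (some i)) ⊆ o ∧
      closure o ⊆ W (some i) := fun i =>
    normal_exists_closure_subset isClosed_closure ((hA i).preimage f.continuous) (hvc (some i))
  choose o ho hvo' hoc using hex
  refine ⟨f.comp g, fun i => g ⁻¹' closure (v (some i)), fun i => g ⁻¹' o i,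
    fun i => g ⁻¹' v (some i), hφ, fun i => isClosed_closure.preimage g.continuous,
    fun i => (ho i).preimage g.continuous, fun i => ?_, fun i => Set.preimage_mono (hvo' i),
    fun i => (hvo _).preimage g.continuous, fun i => Set.preimage_mono subset_closure, ?_⟩
  · rcases (A i).eq_empty_or_nonempty with h' | h'
    · have hempty : IsEmpty (g ⁻¹' o i) := by
        refine ⟨fun x => ?_⟩
        have : f (g x) ∈ A i := hoc i (subset_closure x.2)
        rw [h'] at this
        exact this
      refine ⟨Classical.arbitrary X, ?_⟩
      have : inclusion (g ⁻¹' o i) = ContinuousMap.const _ (Classical.arbitrary X) := by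
        ext x
        exact hempty.elim x
      rw [this]
    · obtain ⟨x, hx⟩ := ((hsolid i).resolve_left h'.ne_empty).nullhomotopic h' f
        (D := closure (o i)) isClosed_closure fun z hz => hoc i hz
      refine ⟨x, ?_⟩
      let k : C((g ⁻¹' o i : Set X), (closure (o i) : Set K)) :=
        ⟨fun y => ⟨g y, subset_closure y.2⟩, by fun_prop⟩
      have h1 : ((f.comp g).comp (inclusion (g ⁻¹' o i))).Homotopic
          ((ContinuousMap.id X).comp (inclusion (g ⁻¹' o i))) :=
        ContinuousMap.Homotopic.comp hφ (ContinuousMap.Homotopic.refl _)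
      rw [ContinuousMap.id_comp] at h1
      have h2 : ((f.comp (inclusion (closure (o i)))).comp k).Homotopic
          ((ContinuousMap.const _ x).comp k) :=
        ContinuousMap.Homotopic.comp hx (ContinuousMap.Homotopic.refl _)
      exact h1.symm.trans h2
  · ext x
    simp only [Set.mem_univ, iff_true]
    have : g x ∈ ⋃ i, v i := hvu ▸ Set.mem_univ _
    obtain ⟨i, hi⟩ := Set.mem_iUnion.1 this
    cases i with
    | none => exact Or.inr (hvc none (subset_closure hi))
    | some i => exact Or.inl (Set.mem_iUnion.2 ⟨i, hi⟩)

theorem cat_biUnion_le {ι : Type*} (B : Finset ι) (E O : ι → Set X) (hO : ∀ i, IsOpen (O i))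
    (hOc : ∀ i, IsCategorical (O i)) (hEO : ∀ i, E i ⊆ O i) :
    cat (⋃ i ∈ B, E i) ≤ (B.card : ℕ∞) := by
  refine iInf₂_le B.card ⟨fun k => O (B.equivFin.symm k), fun k => hO _, fun k => hOc _, ?_⟩
  intro x hx
  simp only [Set.mem_iUnion] at hx ⊢
  obtain ⟨i, hi, hx⟩ := hx
  exact ⟨B.equivFin ⟨i, hi⟩, by simpa using hEO i hx⟩

/-- Vanishing at level k' implies vanishing at all lower levels. If it failed at k, every admissible
k' would be at most k - 1, and so would their supremum. -/
theorem restrict_eq_zero_of_le_cwgt {n : ℕ} {u : Cohomology X R n} {k : ℕ} (hk : 1 ≤ k)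
    (h : (k : ℕ∞) ≤ cwgt u) {A : Set X} (hA : IsClosed A) (hcat : cat A ≤ (k : ℕ∞)) :
    restrict u A = 0 := by
  by_contra hne
  have : cwgt u ≤ ((k - 1 : ℕ) : ℕ∞) := by
    refine iSup₂_le fun k' hk' => ?_
    by_contra hlt
    have hlt : k - 1 < k' := by exact_mod_cast not_le.1 hlt
    have hkk : (k : ℕ∞) ≤ (k' : ℕ∞) := by exact_mod_cast (by omega : k ≤ k')
    exact hne (hk' A hA (hcat.trans hkk))
  have h2 : k ≤ k - 1 := by exact_mod_cast h.trans this
  omega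

/-- The factors of `t` share out `B`: each `u` takes at most w(u) indices and vanishes on the closed
union of their `E i`. The open sets `P i` inside are what the cup product argument needs. -/
theorem exactOn_productCochain_append (w : WeightEstimator X R) {ι : Type*} [DecidableEq ι]
    (E O P : ι → Set X) (hE : ∀ i, IsClosed (E i)) (hO : ∀ i, IsOpen (O i))
    (hOc : ∀ i, IsCategorical (O i)) (hEO : ∀ i, E i ⊆ O i) (hP : ∀ i, IsOpen (P i))
    (hPE : ∀ i, P i ⊆ E i) {Q : Set X} (hQ : IsOpen Q) (s' : List (HomogeneousClass X R))
    (hs' : ExactOn (productCochain s' (degSum s')) Q) (t : List (HomogeneousClass X R))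
    (ht : ∀ u ∈ t, u.cls ≠ 0) (B : Finset ι) (hB : B.card ≤ w.weightSum t) :
    ExactOn (productCochain (t ++ s') (degSum (t ++ s'))) ((⋃ i ∈ B, P i) ∪ Q) := by
  induction t generalizing B with
  | nil =>
    have hB0 : B = ∅ := Finset.card_eq_zero.1 (Nat.le_zero.1 hB)
    subst hB0
    simpa using hs'
  | cons u t ih =>
    have hB' : B.card ≤ w.weight u + w.weightSum t := by
      simpa [WeightEstimator.weightSum] using hB
    have hu0 : u.cls ≠ 0 := ht u List.mem_cons_self
    obtain ⟨B₁, hB₁, hcard⟩ := Finset.exists_subset_card_eq (min_le_left B.card (w.weight u))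
    have hB₂ : (B \ B₁).card ≤ w.weightSum t := by
      rw [Finset.card_sdiff_of_subset hB₁, hcard]
      omega
    have hrest := ih (fun v hv => ht v (List.mem_cons_of_mem _ hv)) (B \ B₁) hB₂
    have hu : ExactOn u.rep.1 (⋃ i ∈ B₁, P i) := by
      refine ExactOn.mono (T := ⋃ i ∈ B₁, E i) ?_ (Set.iUnion₂_mono fun i _ => hPE i)
      refine exactOn_of_restrict_eq_zero u.rep _ ?_
      rw [u.mk_rep]
      refine restrict_eq_zero_of_le_cwgt (w.one_le u hu0) (w.le_cwgt u hu0)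
        (B₁.finite_toSet.isClosed_biUnion fun i _ => hE i) ?_
      refine (cat_biUnion_le B₁ E O hO hOc hEO).trans ?_
      exact_mod_cast hcard.le.trans (min_le_right _ _)
    have h := ExactOn.cup (n := degSum (u :: (t ++ s'))) rfl u.one_le_deg u.rep
      ⟨_, productCochain_mem_cocycles (t ++ s') rfl⟩
      (isOpen_biUnion fun i (_ : i ∈ B₁) => hP i)
      ((isOpen_biUnion fun i (_ : i ∈ B \ B₁) => hP i).union hQ) hu hrest
    rw [List.cons_append, productCochain_cons (n := degSum (u :: (t ++ s'))) rfl rfl]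
    refine h.mono ?_
    rw [← Set.union_assoc]
    refine Set.union_subset_union_left _ (Set.iUnion₂_subset fun i hi => ?_)
    intro x hx
    simp only [Set.mem_union, Set.mem_iUnion]
    by_cases h1 : i ∈ B₁
    · exact Or.inl ⟨i, h1, hx⟩
    · exact Or.inr ⟨i, Finset.mem_sdiff.2 ⟨hi, h1⟩, hx⟩

theorem product_eq_zero_of_exactOn [Nonempty X] (hX : HasCWHomotopyType X)
    (w : WeightEstimator X R) {s s' t : List (HomogeneousClass X R)} (hperm : s.Perm (t ++ s'))
    (hs0 : ∀ u ∈ s, u.cls ≠ 0) {j : ℕ} (hj : j ≤ w.weightSum t) (A : Fin j → Set X)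
    (hA : ∀ i, IsOpen (A i)) (hsolid : ∀ i, A i = ∅ ∨ IsSolid (A i)) (V : Set X) (hV : IsOpen V)
    (hcover : (⋃ i, A i) ∪ V = Set.univ)
    (hex : V = ∅ ∨ 1 ≤ degSum s' ∧ ExactOn (productCochain s' (degSum s')) V) :
    product s = 0 := by
  obtain ⟨φ, E, O, P, hφ, hE, hO, hOc, hEO, hP, hPE, hPV⟩ :=
    hX.exists_categorical_shrinking A hA hsolid V hV hcover
  have hQ : ExactOn (productCochain s' (degSum s')) (φ ⁻¹' V) := by
    rcases hex with rfl | ⟨hd, h⟩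
    · exact exactOn_empty _
    · exact h.preimage hφ hd (productCochain_mem_cocycles s' rfl)
  have h := exactOn_productCochain_append w E O P hE hO hOc hEO hP hPE
    (hV.preimage φ.continuous) s' hQ t
    (fun u hu => hs0 u (hperm.mem_iff.2 (List.mem_append_left _ hu))) Finset.univ (by simpa using hj)
  simp only [Finset.mem_univ, Set.iUnion_true] at h
  rw [hPV, exactOn_univ_iff] at h
  exact product_eq_zero_of_perm hperm h

theorem degSum_pos {s : List (HomogeneousClass X R)} (hs : s ≠ []) : 1 ≤ degSum s := by
  cases s with
  | nil => exact absurd rfl hs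
  | cons u s => exact u.one_le_deg.trans (Nat.le_add_right _ _)

theorem weightSum_perm (w : WeightEstimator X R) {s t : List (HomogeneousClass X R)}
    (h : s.Perm t) : w.weightSum s = w.weightSum t := (h.map _).sum_eq

theorem weightSum_append (w : WeightEstimator X R) (s t : List (HomogeneousClass X R)) :
    w.weightSum (s ++ t) = w.weightSum s + w.weightSum t := by
  simp [WeightEstimator.weightSum]

/-! ### Removing simplices from the nerve of a good cover -/

variable {𝒰 : Finset (Set X)}

theorem IsGoodCover.contractibleSpace_biInter (h : IsGoodCover (𝒰 : Set (Set X)))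
    {t : Finset (Set X)} (ht : t ⊆ 𝒰) (hne : t.Nonempty) (hint : (⋂ U ∈ t, U).Nonempty) :
    ContractibleSpace (⋂ U ∈ t, U : Set X) := by
  have e : ⋂₀ (t : Set (Set X)) = ⋂ U ∈ t, U := Set.sInter_eq_biInter
  rw [← e] at hint ⊢
  exact h.contractible_inter t (by exact_mod_cast ht) t.finite_toSet (by exact_mod_cast hne) hint

/-- The common point makes every subfamily intersect, hence contractibly. -/
theorem IsGoodCover.isSolid_biUnion [DecidableEq (Set X)] (h : IsGoodCover (𝒰 : Set (Set X)))
    {t : Finset (Set X)} (ht : t ⊆ 𝒰) (hint : (⋂ U ∈ t, U).Nonempty) :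
    (⋃ U ∈ t, U) = ∅ ∨ IsSolid (⋃ U ∈ t, U) := by
  rcases t.eq_empty_or_nonempty with rfl | hne
  · exact Or.inl (by simp)
  · refine Or.inr (CovType.isSolid_biUnion t hne (fun U => U) (fun U hU => h.isOpen U (ht hU))
      fun t' ht' hne' => ?_)
    have := h.contractibleSpace_biInter (ht'.trans ht) hne'
      (hint.mono (Set.biInter_subset_biInter_left ht'))
    exact isSolid_of_contractibleSpace _

theorem IsGoodCover.isAcyclicSet_biInter (h : IsGoodCover (𝒰 : Set (Set X)))
    {t : Finset (Set X)} (ht : t ⊆ 𝒰) (hne : t.Nonempty) : IsAcyclicSet R (⋂ U ∈ t, U) := by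
  rcases (⋂ U ∈ t, U).eq_empty_or_nonempty with h0 | hint
  · rw [h0]
    exact fun q f _ => exactOn_empty f
  · have := h.contractibleSpace_biInter ht hne hint
    exact isAcyclicSet_of_contractibleSpace _

/-- After the removal of `j` simplices of the nerve of a good cover, a non-zero product of weight at
most `w(s) - j` forces a simplex of its dimension in the nerve of what is left. -/
theorem IsGoodCover.exists_simplex [DecidableEq (Set X)] [Nonempty X] (hX : HasCWHomotopyType X)
    (h : IsGoodCover (𝒰 : Set (Set X))) (w : WeightEstimator X R)
    {s s' : List (HomogeneousClass X R)} (hs : product s ≠ 0) (hsub : s'.Subperm s) {j : ℕ}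
    (hj : w.weightSum s' + j ≤ w.weightSum s) (σ : Fin j → Finset (Set X)) (hσ : ∀ i, σ i ⊆ 𝒰)
    (hint : ∀ i, (⋂ U ∈ σ i, U).Nonempty) {𝒱 : Finset (Set X)} (h𝒱 : 𝒱 ⊆ 𝒰)
    (hcover : ∀ U ∈ 𝒰, U ∈ 𝒱 ∨ ∃ i, U ∈ σ i) :
    𝒱.Nonempty ∧ ∃ t ⊆ 𝒱, (t.card : ℤ) = 1 + dim s' ∧ (⋂ U ∈ t, U).Nonempty := by
  have hs0 : ∀ u ∈ s, u.cls ≠ 0 := fun u hu => cls_ne_zero_of_mem hs hu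
  obtain ⟨l, hl, hls⟩ := hsub
  obtain ⟨t, ht⟩ := hls.exists_perm_append
  have hperm : s.Perm (t ++ s') := ht.trans ((hl.append_right t).trans List.perm_append_comm)
  have hjt : j ≤ w.weightSum t := by
    have := weightSum_perm w hperm
    rw [weightSum_append] at this
    omega
  have hA : ∀ i, IsOpen (⋃ U ∈ σ i, U) := fun i =>
    isOpen_biUnion fun U hU => h.isOpen U (hσ i hU)
  have hV : IsOpen (⋃ U ∈ 𝒱, U) := isOpen_biUnion fun U hU => h.isOpen U (h𝒱 hU)
  have hcov : (⋃ i, ⋃ U ∈ σ i, U) ∪ (⋃ U ∈ 𝒱, U) = Set.univ := by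
    ext x
    simp only [Set.mem_univ, iff_true]
    have hx : x ∈ ⋃₀ (𝒰 : Set (Set X)) := h.covers ▸ Set.mem_univ x
    obtain ⟨U, hU, hxU⟩ := hx
    rcases hcover U hU with hU | ⟨i, hi⟩
    · exact Or.inr (Set.mem_biUnion hU hxU)
    · exact Or.inl (Set.mem_iUnion.2 ⟨i, Set.mem_biUnion hi hxU⟩)
  have hno : ∀ hex, False := fun hex => hs (product_eq_zero_of_exactOn hX w hperm hs0 hjt
    (fun i => ⋃ U ∈ σ i, U) hA (fun i => h.isSolid_biUnion (hσ i) (hint i)) _ hV hcov hex)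
  constructor
  -- With nothing left, the removed unions alone cover X and `t` kills them.
  · rw [Finset.nonempty_iff_ne_empty]
    rintro rfl
    exact hno (Or.inl (by simp))
  · by_cases hnil : s' = []
    · subst hnil
      -- The convention dim [] = -1 asks for the empty simplex, whose intersection is all of X.
      exact ⟨∅, by simp, by simp [dim], by simp⟩
    · have hd := degSum_pos hnil
      have hdim : dim s' = degSum s' := by
        cases s' with
        | nil => exact absurd rfl hnil
        | cons u s' => rfl
      by_contra hcon
      push Not at hcon
      refine hno (Or.inr ⟨hd, ?_⟩)
      have key := exactOn_biUnion_of_forall_card_eq (R := R) 𝒱 (fun U => U)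
        (fun U hU => h.isOpen U (h𝒱 hU))
        (fun t ht hne => h.isAcyclicSet_biInter (ht.trans h𝒱) hne) (degSum s') hd
        (fun t ht hcard => hcon t ht (by rw [hdim, hcard]; push_cast; ring))
      have hcoc := productCochain_mem_cocycles s' rfl
      obtain ⟨q, hq⟩ : ∃ q, degSum s' = q + 1 := ⟨degSum s' - 1, by omega⟩
      rw [hq] at key hcoc ⊢
      refine key q le_rfl _ ?_
      rw [show coboundary X R (q + 1) (productCochain s' (q + 1)) = 0 from hcoc]
      exact fun _ _ => rfl

theorem IsGoodCover.exists_remove_simplices [DecidableEq (Set X)] [Nonempty X]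
    (hX : HasCWHomotopyType X)
    (h : IsGoodCover (𝒰 : Set (Set X))) (w : WeightEstimator X R)
    {s : List (HomogeneousClass X R)} (hs : product s ≠ 0) {j : ℕ} (hj : j ≤ w.weightSum s) :
    ∃ σ : Fin j → Finset (Set X), (∀ i, σ i ⊆ 𝒰) ∧ (∀ i, (⋂ U ∈ σ i, U).Nonempty) ∧
      ∃ 𝒱 ⊆ 𝒰, (∀ U ∈ 𝒰, U ∈ 𝒱 ∨ ∃ i, U ∈ σ i) ∧
        (𝒱.card : ℤ) + ∑ i ∈ Finset.range j, (1 + sSup (dimSet w s (w.weightSum s - i))) =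
          𝒰.card := by
  induction j with
  | zero => exact ⟨fun i => i.elim0, fun i => i.elim0, fun i => i.elim0, 𝒰, subset_rfl,
      fun U hU => Or.inl hU, by simp⟩
  | succ j ih =>
    obtain ⟨σ, hσ, hint, 𝒱, h𝒱, hcover, hcard⟩ := ih (by omega)
    -- Weight at most W - j leaves weight at least j for the complementary factors, enough for the j
    -- simplices already removed.
    obtain ⟨s', hsub, hw, hdim⟩ := (isGreatest_dimSet w s (w.weightSum s - j)).1
    obtain ⟨-, t, ht, htcard, htne⟩ := h.exists_simplex hX w hs hsub (by omega) σ hσ hint h𝒱 hcover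
    refine ⟨Fin.snoc σ t, fun i => ?_, fun i => ?_, 𝒱 \ t, Finset.sdiff_subset.trans h𝒱,
      fun U hU => ?_, ?_⟩
    · refine Fin.lastCases ?_ (fun i => ?_) i
      · simpa using ht.trans h𝒱
      · simpa using hσ i
    · refine Fin.lastCases ?_ (fun i => ?_) i
      · simpa using htne
      · simpa using hint i
    · by_cases hUt : U ∈ t
      · exact Or.inr ⟨Fin.last j, by simpa using hUt⟩
      · rcases hcover U hU with hU | ⟨i, hi⟩
        · exact Or.inl (Finset.mem_sdiff.2 ⟨hU, hUt⟩)
        · exact Or.inr ⟨i.castSucc, by simpa using hi⟩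
    · rw [Finset.sum_range_succ, hdim, ← htcard, ← hcard,
        ← Finset.card_sdiff_add_card_eq_card ht]
      push_cast
      ring

theorem sum_range_sub_eq_sum_Icc (m : ℕ → ℤ) (W : ℕ) :
    ∑ i ∈ Finset.range W, m (W - i) = ∑ k ∈ Finset.Icc 1 W, m k := by
  refine Finset.sum_bij' (fun i _ => W - i) (fun k _ => W - k) ?_ ?_ ?_ ?_ (fun _ _ => rfl) <;>
    simp only [Finset.mem_range, Finset.mem_Icc] <;> intros <;> omega

theorem IsGoodCover.wct_le_card [Nonempty X] (hX : HasCWHomotopyType X)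
    (h : IsGoodCover (𝒰 : Set (Set X))) (w : WeightEstimator X R)
    {s : List (HomogeneousClass X R)} (hs : product s ≠ 0) : wct w s ≤ 𝒰.card := by
  classical
  obtain ⟨σ, hσ, hint, 𝒱, h𝒱, hcover, hcard⟩ := h.exists_remove_simplices hX w hs le_rfl
  -- The whole weight of `s` is spent on the removed simplices; the member that survives is the
  -- leading 1 of `wct`.
  obtain ⟨hne, -⟩ := h.exists_simplex hX w hs (s' := []) List.nil_subperm
    (by simp [WeightEstimator.weightSum]) σ hσ hint h𝒱 hcover
  have h1 : (1 : ℤ) ≤ 𝒱.card := by exact_mod_cast hne.card_pos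
  rw [Finset.sum_add_distrib,
    sum_range_sub_eq_sum_Icc (fun k => sSup (dimSet w s k))] at hcard
  simp only [Finset.sum_const, Finset.card_range, nsmul_eq_mul, mul_one] at hcard
  rw [wct, ← hcard]
  linarith

end Main

end CovType
end

theorem theorem3p2 {X : Type*} [TopologicalSpace X] [PathConnectedSpace X]
    (hX : CovType.HasCWHomotopyType X) {R : Type*} [CommRing R]
    (w : CovType.WeightEstimator X R) (s : List (CovType.HomogeneousClass X R))
    (hs : CovType.product s ≠ 0) :
    ((CovType.wct w s).toNat : ℕ∞) ≤ CovType.sct X := by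
  refine le_iInf₂ fun 𝒰 h𝒰 => ?_
  by_cases hfin : 𝒰.Finite
  · rw [hfin.encard_eq_coe_toFinset_card]
    have h : CovType.IsGoodCover (hfin.toFinset : Set (Set X)) := by
      rwa [hfin.coe_toFinset]
    -- `toNat` truncates nothing, since `wct` is positive by `one_le_wct`.
    exact_mod_cast Int.toNat_le.2 (h.wct_le_card hX w hs)
  · rw [Set.Infinite.encard_eq hfin]
    exact le_top
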